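/- Theorem 1.1. Let $(X,\mathcal X,\mu)$ be a probability space and let $G$ be a nilpotent group of (invertible) measure preserving transformations of $(X,\mathcal X,\mu)$, where transformations that agree $\mu$-almost everywhere are identified. For $S\in G$ and a function $f$ on $X$ write $(Sf)(x)=f(Sx)$. Let $T_1,\dots,T_l\in G$, let $f_1,\dots,f_d\in L^\infty(X,\mathcal X,\mu)$ be real or complex valued, and let $p_{i,j}$ ($1\le i\le l$, $1\le j\le d$) be integer valued polynomials, i.e. polynomials with real coefficients such that $p_{i,j}(n)\in\mathbb Z$ for every $n\in\mathbb Z$. Then the averages $$\frac1N\sum_{n=1}^N\prod_{j=1}^d\left(T_1^{p_{1,j}(n)}\cdots T_l^{p_{l,j}(n)}\right)f_j$$ converge in $L^2(X,\mathcal X,\mu)$ as $N\to\infty$: there is $F\in L^2(X,\mathcal X,\mu)$ such that the $L^2$ norm of the difference between the $N$-th average and $F$ tends to $0$. -/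

import Mathlib

open MeasureTheory

/-- A function `p : ℤ → ℤ` is an integer valued polynomial if it is the restriction to `ℤ` of a
polynomial. The coefficients need not be integers: `n ↦ n (n - 1) / 2` is allowed. -/
def IsIntegerValuedPolynomial (p : ℤ → ℤ) : Prop :=
  ∃ P : Polynomial ℝ, ∀ n : ℤ, P.eval (n : ℝ) = (p n : ℝ)

/-- The group `G` acts on `(X, μ)` by measure preserving transformations `τ g : X → X`, where
transformations which agree almost everywhere are identified, so that the group laws are required
only almost everywhere. In particular this covers every group `G` of invertible measure preserving
maps `X → X` under composition, with `τ g = g`. -/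
structure IsMeasurePreservingGroup {G X : Type*} [Group G] [MeasurableSpace X]
    (μ : Measure X) (τ : G → X → X) : Prop where
  measurePreserving : ∀ g : G, MeasurePreserving (τ g) μ μ
  map_one : τ 1 =ᵐ[μ] id
  map_mul : ∀ g h : G, τ (g * h) =ᵐ[μ] τ g ∘ τ h

/-- The element `T₁ ^ p₁(n) ⋯ Tₗ ^ pₗ(n)` of `G`, the factors being multiplied in this order. -/
def polynomialProduct {G : Type*} [Group G] {l : ℕ} (T : Fin l → G) (p : Fin l → ℤ → ℤ) (n : ℤ) :
    G :=
  (List.ofFn fun i => T i ^ p i n).prod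

/-- The multiple polynomial ergodic average
`(1 / N) ∑_{n = 1}^N ∏_j (T₁ ^ p₁ⱼ(n) ⋯ Tₗ ^ pₗⱼ(n)) fⱼ`, where a transformation `S` acts on a
function `f` by `(S f)(x) = f (S x)`. -/
noncomputable def polynomialAverage {𝕜 G X : Type*} [RCLike 𝕜] [Group G] (τ : G → X → X)
    {l d : ℕ} (T : Fin l → G) (p : Fin l → Fin d → ℤ → ℤ) (f : Fin d → X → 𝕜) (N : ℕ) (x : X) :
    𝕜 :=
  (N : 𝕜)⁻¹ * ∑ n ∈ Finset.Icc 1 N,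
    ∏ j : Fin d, f j (τ (polynomialProduct T (fun i => p i j) (n : ℤ)) x)

/-!
# Norm convergence of polynomial multiple averages of nilpotent groups

The proof follows the strategy of Walsh, with ultrafilter limits in place of quantitative
metastability.

A *system* is a finite family of sequences `g i : ℤ → G`; its averages are those of the products of
translates of bounded functions `f i` by `g i n`. Fix a nonprincipal ultrafilter `p` on `ℕ`, and let
the system and the functions depend on a parameter `k`. The statement proved by induction is that
the averages of length `N` are Cauchy in the ultraproduct (`UltraCauchy`): for large fixed `N`, `N'`
they are close for `p`-almost every `k`. For data constant in `k` this is the Cauchy property in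
`L²`; for varying data it expresses the uniformity which the induction needs.

*Analysis.* Fix a member `g j` of the system, and regard the averages as linear contractions, up to
a constant, applied to the function `u` at `j`. The inner product of such an average of length `N`
with a bounded function `b` is the inner product of `u` with the corresponding dual average of `b`.
Hence, if convergence holds for the dual averages whose length tends to infinity along `p`, then it
holds for all `u`: project `u` to the space of functions for which convergence holds
(`L2Action.ultraCauchy_weightedAverage`). For `u` a dual average of length `N k`, a shift of the
summation variable turns the averages of fixed length `M` into means over `n < N k` of averages of
the reduced systems `reduceSystem g j n`, up to an error `O(M / N k)`
(`L2Action.systemAverage_reduceSystem`). Such means converge when the reduced systems converge for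
each choice `n k` of the steps; this is a form of Egorov's theorem (`UltraCauchy.average`).
So a sequence of systems converges as soon as all its reductions do
(`L2Action.SystemConverges.of_reduceSystem`).

*Algebra.* By the Lazard–Leibman theorem, polynomial sequences in a nilpotent group form a chain of
groups `P 0 ≥ P 1 ≥ ⋯ ≥ P r = 1` such that discrete derivatives map `P i` to `P (i + 1)`
(`exists_isDerivChain`). Reduction along `g j` removes `g j`. If `g i` lies in the same left coset
of `P e` as `g j`, then the new member made from `g i` lies in the same left coset of `P (e + 1)` as
`g i`. Hence no new cosets are occupied along the path of cosets of `g j`, one coset is vacated, and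
the numbers of occupied cosets, taken along a suitable member and ordered lexicographically, go down
(`IsPivot.exists_reduceSystem_lex`). Repeated reduction ends with the trivial system.
-/

/-! ### Polynomial sequences in a nilpotent group -/

section LowerCentral

variable {G : Type*} [Group G]

/-- The inclusion `[γ_a, γ_b] ≤ γ_{a+b}` for the lower central series; the shift by one appears
because `lowerCentralSeries` starts from the index `0` instead of `1`. -/
theorem commutator_lowerCentralSeries_le (a b : ℕ) :
    ⁅(⊤ : Subgroup G).lowerCentralSeries a, (⊤ : Subgroup G).lowerCentralSeries b⁆ ≤
      (⊤ : Subgroup G).lowerCentralSeries (a + b + 1) := by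
  induction b generalizing a with
  | zero => exact le_of_eq rfl
  | succ b ih =>
    -- the three subgroups lemma, applied in the quotient by the normal subgroup on the right
    set N := (⊤ : Subgroup G).lowerCentralSeries (a + (b + 1) + 1) with hN
    have key : ∀ K : Subgroup G, K.map (QuotientGroup.mk' N) = ⊥ ↔ K ≤ N := fun K => by
      rw [Subgroup.map_eq_bot_iff, QuotientGroup.ker_mk']
    rw [Subgroup.commutator_comm, Subgroup.lowerCentralSeries_succ, ← key,
      Subgroup.map_commutator, Subgroup.map_commutator]
    refine Subgroup.commutator_commutator_eq_bot_of_rotate ?_ ?_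
    · rw [← Subgroup.map_commutator, ← Subgroup.map_commutator, key, Subgroup.commutator_comm ⊤,
        ← Subgroup.lowerCentralSeries_succ]
      refine (ih (a + 1)).trans (le_of_eq ?_)
      rw [hN]; congr 1; omega
    · rw [← Subgroup.map_commutator, ← Subgroup.map_commutator, key]
      exact Subgroup.commutator_mono (ih a) le_rfl

end LowerCentral

section Shift

open scoped commutatorElement

variable {G : Type*} [Group G]

/-- The discrete derivative `n ↦ u(n)⁻¹ u(n + m)` of a sequence in a group. -/
def seqDiff (m : ℤ) (u : ℤ → G) : ℤ → G := fun n => (u n)⁻¹ * u (n + m)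

/-- The translate `n ↦ u(n + m)` of a sequence. -/
def seqShift (m : ℤ) (u : ℤ → G) : ℤ → G := fun n => u (n + m)

theorem seqShift_eq (m : ℤ) (u : ℤ → G) : seqShift m u = u * seqDiff m u := by
  ext n; simp [seqShift, seqDiff]

theorem seqShift_neg_seqShift {A : Type*} (m : ℤ) (u : ℤ → A) : seqShift (-m) (seqShift m u) = u := by
  ext n; simp [seqShift]

theorem seqDiff_mul (m : ℤ) (u v : ℤ → G) :
    seqDiff m (u * v) = v⁻¹ * seqDiff m u * v * seqDiff m v := by
  ext n; simp [seqDiff, mul_assoc]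

theorem seqDiff_commutator (m : ℤ) (u v : ℤ → G) :
    seqDiff m ⁅u, v⁆ = v * (u * (v⁻¹ * ⁅seqDiff m u, v⁆ * v * ⁅seqDiff m u, seqDiff m v⁆) * u⁻¹ *
      ⁅u, seqDiff m v⁆) * v⁻¹ := by
  ext n; simp [seqDiff, commutatorElement_def, mul_assoc]

/-- `u` is a polynomial sequence of level `i` for the filtration `V`: it takes values in `V i`, its
derivatives take values in `V (i + 1)`, and so on. This is the greatest predicate with that
property. Derivatives of `u⁻¹` are included so that the definition is visibly stable under
inversion. -/
def IsPolySeq (V : ℕ → Subgroup G) (i : ℕ) (u : ℤ → G) : Prop :=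
  ∃ Q : ℕ → Set (ℤ → G), u ∈ Q i ∧ ∀ j, ∀ v ∈ Q j,
    (∀ n, v n ∈ V j) ∧ ∀ m, seqDiff m v ∈ Q (j + 1) ∧ seqDiff m v⁻¹ ∈ Q (j + 1)

variable {V : ℕ → Subgroup G}

theorem isPolySeq_iff {i : ℕ} {u : ℤ → G} : IsPolySeq V i u ↔ (∀ n, u n ∈ V i) ∧
    ∀ m, IsPolySeq V (i + 1) (seqDiff m u) ∧ IsPolySeq V (i + 1) (seqDiff m u⁻¹) := by
  have fwd : ∀ {i : ℕ} {u : ℤ → G}, IsPolySeq V i u → (∀ n, u n ∈ V i) ∧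
      ∀ m, IsPolySeq V (i + 1) (seqDiff m u) ∧ IsPolySeq V (i + 1) (seqDiff m u⁻¹) := by
    rintro i u ⟨Q, hu, hQ⟩
    exact ⟨(hQ i u hu).1, fun m => ⟨⟨Q, ((hQ i u hu).2 m).1, hQ⟩, ⟨Q, ((hQ i u hu).2 m).2, hQ⟩⟩⟩
  refine ⟨fwd, fun h => ⟨fun i => {u | (∀ n, u n ∈ V i) ∧ ∀ m, IsPolySeq V (i + 1) (seqDiff m u) ∧
    IsPolySeq V (i + 1) (seqDiff m u⁻¹)}, h, fun j v hv => ⟨hv.1, fun m => ⟨?_, ?_⟩⟩⟩⟩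
  · exact fwd (hv.2 m).1
  · exact fwd (hv.2 m).2

theorem IsPolySeq.one (i : ℕ) : IsPolySeq V i (1 : ℤ → G) := by
  refine ⟨fun _ => {1}, rfl, ?_⟩
  rintro j v rfl
  refine ⟨fun n => (V j).one_mem, fun m => ⟨?_, ?_⟩⟩ <;> · ext n; simp [seqDiff]

theorem IsPolySeq.inv {i : ℕ} {u : ℤ → G} (hu : IsPolySeq V i u) : IsPolySeq V i u⁻¹ := by
  rw [isPolySeq_iff] at hu ⊢
  exact ⟨fun n => (V i).inv_mem (hu.1 n), fun m => ⟨(hu.2 m).2, by simpa using (hu.2 m).1⟩⟩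

theorem IsPolySeq.seqDiff {i : ℕ} {u : ℤ → G} (hu : IsPolySeq V i u) (m : ℤ) :
    IsPolySeq V (i + 1) (seqDiff m u) := ((isPolySeq_iff.1 hu).2 m).1

theorem IsPolySeq.anti (hV : Antitone V) {i j : ℕ} (hij : i ≤ j) {u : ℤ → G}
    (hu : IsPolySeq V j u) : IsPolySeq V i u := by
  obtain ⟨Q, hu, hQ⟩ := hu
  refine ⟨fun a => Q (a + (j - i)), by simpa [Nat.add_sub_cancel' hij] using hu, fun a v hv =>
    ⟨fun n => hV (Nat.le_add_right _ _) ((hQ _ v hv).1 n), fun m => ?_⟩⟩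
  have := (hQ _ v hv).2 m
  rwa [show a + (j - i) + 1 = a + 1 + (j - i) by omega] at this

theorem IsPolySeq.eq_one {r : ℕ} (hV : Antitone V) (hr : V r = ⊥) {i : ℕ} (hi : r ≤ i)
    {u : ℤ → G} (hu : IsPolySeq V i u) : u = 1 := by
  ext n
  have := hV hi ((isPolySeq_iff.1 hu).1 n)
  rwa [hr, Subgroup.mem_bot] at this

/-- The Lazard–Leibman theorem: for a filtration of finite length, polynomial sequences of
level `i` are closed under products, and commutators add levels. Both facts are proved together,
by downward induction on the level, from the Leibniz rules for `seqDiff`. -/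
theorem isPolySeq_mul_and_commutator {r : ℕ} (hV : Antitone V) (hr : V r = ⊥)
    (hc : ∀ i j, ⁅V i, V j⁆ ≤ V (i + j)) (k t : ℕ) (hk : r ≤ t + k) :
    (∀ i, t ≤ i → ∀ u v, IsPolySeq V i u → IsPolySeq V i v → IsPolySeq V i (u * v)) ∧
    (∀ i j, t ≤ i + j → ∀ u v, IsPolySeq V i u → IsPolySeq V j v → IsPolySeq V (i + j) ⁅u, v⁆) := by
  have hval : ∀ i j u v, IsPolySeq V i u → IsPolySeq V j v → ∀ n, ⁅u, v⁆ n ∈ V (i + j) :=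
    fun i j u v hu hv n => hc i j (Subgroup.commutator_mem_commutator
      ((isPolySeq_iff.1 hu).1 n) ((isPolySeq_iff.1 hv).1 n))
  induction k generalizing t with
  | zero =>
    refine ⟨fun i hi u v hu hv => ?_, fun i j hij u v hu hv => ?_⟩
    · rw [hu.eq_one hV hr (by omega), one_mul]; exact hv
    · have : ⁅u, v⁆ = 1 := by
        ext n
        have := hV (show r ≤ i + j by omega) (hval i j u v hu hv n)
        rwa [hr, Subgroup.mem_bot] at this
      rw [this]; exact IsPolySeq.one _
  | succ k ih =>
    obtain ⟨ihm, ihc⟩ := ih (t + 1) (by omega)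
    have hconj : ∀ s i w x, t + 1 ≤ s → IsPolySeq V i w → IsPolySeq V s x →
        IsPolySeq V s (w * x * w⁻¹) := by
      intro s i w x hs hw hx
      have : w * x * w⁻¹ = ⁅w, x⁆ * x := by simp [commutatorElement_def]
      rw [this]
      exact ihm s hs _ _ ((ihc i s (by omega) w x hw hx).anti hV (by omega)) hx
    refine ⟨fun i hi u v hu hv => ?_, fun i j hij u v hu hv => ?_⟩
    · have hd : ∀ u v, IsPolySeq V i u → IsPolySeq V i v → ∀ m,
          IsPolySeq V (i + 1) (seqDiff m (u * v)) := fun u v hu hv m => by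
        rw [seqDiff_mul]
        refine ihm _ (by omega) _ _ ?_ (hv.seqDiff m)
        simpa using hconj (i + 1) i v⁻¹ _ (by omega) hv.inv (hu.seqDiff m)
      refine isPolySeq_iff.2 ⟨fun n => (V i).mul_mem ((isPolySeq_iff.1 hu).1 n)
        ((isPolySeq_iff.1 hv).1 n), fun m => ⟨hd u v hu hv m, ?_⟩⟩
      rw [mul_inv_rev]
      exact hd _ _ hv.inv hu.inv m
    · have hd : ∀ i j, t ≤ i + j → ∀ u v, IsPolySeq V i u → IsPolySeq V j v → ∀ m,
          IsPolySeq V (i + j + 1) (seqDiff m ⁅u, v⁆) := fun i j hij u v hu hv m => by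
        have h1 := ihc (i + 1) j (by omega) _ _ (hu.seqDiff m) hv
        have h2 := ihc i (j + 1) (by omega) _ _ hu (hv.seqDiff m)
        have h3 := (ihc (i + 1) (j + 1) (by omega) _ _ (hu.seqDiff m) (hv.seqDiff m)).anti hV
          (show i + j + 1 ≤ _ by omega)
        rw [show i + 1 + j = i + j + 1 by omega] at h1
        rw [show i + (j + 1) = i + j + 1 by omega] at h2
        rw [seqDiff_commutator]
        refine hconj _ j v _ (by omega) hv (ihm _ (by omega) _ _ (hconj _ i u _ (by omega) hu
          (ihm _ (by omega) _ _ ?_ h3)) h2)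
        simpa using hconj _ j v⁻¹ _ (by omega) hv.inv h1
      refine isPolySeq_iff.2 ⟨hval i j u v hu hv, fun m => ⟨hd i j hij u v hu hv m, ?_⟩⟩
      rw [commutatorElement_inv, add_comm i j]
      exact hd j i (by omega) v u hv hu m

/-- A decreasing chain of groups of sequences along which discrete derivatives descend, and which
reaches the trivial group after `r` steps. -/
structure IsDerivChain (P : ℕ → Subgroup (ℤ → G)) (r : ℕ) : Prop where
  anti : Antitone P
  eq_bot : P r = ⊥
  seqDiff_mem : ∀ i, ∀ u ∈ P i, ∀ m, seqDiff m u ∈ P (i + 1)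

end Shift

section IntegerValued

variable {G : Type*} [Group G]

/-- A power sequence `n ↦ T ^ p(n)` with `deg p ≤ D` is polynomial for a filtration which starts with
`D + 1` copies of the whole group, because taking derivatives lowers the degree of `p`. -/
theorem isPolySeq_zpow {V : ℕ → Subgroup G} {D : ℕ} (hV : ∀ j ≤ D, V j = ⊤) (T : G) {p : ℤ → ℤ}
    (P : Polynomial ℝ) (hP : ∀ n : ℤ, P.eval (n : ℝ) = (p n : ℝ)) (hD : P.natDegree ≤ D) :
    IsPolySeq V 0 (fun n => T ^ p n) := by
  refine ⟨fun j => {u | ∃ (p : ℤ → ℤ) (P : Polynomial ℝ), (∀ n : ℤ, P.eval (n : ℝ) = (p n : ℝ)) ∧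
    (P = 0 ∨ P.natDegree + j ≤ D) ∧ u = fun n => T ^ p n}, ⟨p, P, hP, Or.inr (by omega), rfl⟩, ?_⟩
  rintro j _ ⟨p, P, hP, hPj, rfl⟩
  have hdiff : ∀ (p : ℤ → ℤ) (P : Polynomial ℝ), (∀ n : ℤ, P.eval (n : ℝ) = (p n : ℝ)) →
      (P = 0 ∨ P.natDegree + j ≤ D) → ∀ m, ∃ (q : ℤ → ℤ) (Q : Polynomial ℝ),
        (∀ n : ℤ, Q.eval (n : ℝ) = (q n : ℝ)) ∧ (Q = 0 ∨ Q.natDegree + (j + 1) ≤ D) ∧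
        seqDiff m (fun n => T ^ p n) = fun n => T ^ q n := by
    intro p P hP hPj m
    refine ⟨fun n => p (n + m) - p n, Polynomial.taylor (m : ℝ) P - P, fun n => ?_, ?_, ?_⟩
    · rw [Polynomial.eval_sub, Polynomial.taylor_eval, hP]
      have := hP (n + m)
      push_cast at this ⊢
      rw [this]
    · by_cases h0 : P = 0
      · left; simp [h0]
      by_cases h1 : Polynomial.taylor (m : ℝ) P - P = 0
      · exact Or.inl h1
      right
      have hlt : (Polynomial.taylor (m : ℝ) P - P).natDegree < P.natDegree := by
        have := Polynomial.degree_sub_lt_left (Polynomial.degree_taylor P (m : ℝ))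
          (by rwa [Ne, Polynomial.taylor_eq_zero])
          (Polynomial.leadingCoeff_taylor (r := (m : ℝ)) (f := P))
        rw [Polynomial.degree_taylor] at this
        exact Polynomial.natDegree_lt_natDegree h1 this
      have := hPj.resolve_left h0
      omega
    · ext n
      rw [seqDiff, ← zpow_neg, ← zpow_add]
      congr 1; ring
  refine ⟨fun n => ?_, fun m => ⟨hdiff p P hP hPj m, ?_⟩⟩
  · rcases hPj with rfl | h
    · have : p n = 0 := by simpa using (hP n).symm
      simp [this]
    · rw [hV j (by omega)]; trivial
  · have : (fun n => T ^ p n)⁻¹ = fun n => T ^ (-p n) := by ext n; simp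
    rw [this]
    exact hdiff (fun n => -p n) (-P) (fun n => by simp [hP]) (by simpa using hPj) m

/-- In a nilpotent group, finitely many sequences of the form `T₁ ^ p₁(n) ⋯ Tₗ ^ pₗ(n)` lie at the
top of a derivative chain of finite length. -/
theorem exists_isDerivChain [Group.IsNilpotent G] {l d : ℕ} (T : Fin l → G)
    (p : Fin l → Fin d → ℤ → ℤ) (hp : ∀ i j, IsIntegerValuedPolynomial (p i j)) :
    ∃ (P : ℕ → Subgroup (ℤ → G)) (r : ℕ), IsDerivChain P r ∧
      ∀ j, (fun n => polynomialProduct T (fun i => p i j) n) ∈ P 0 := by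
  choose R hR using hp
  -- a positive bound for the degrees
  let D : ℕ := 1 + ∑ i, ∑ j, (R i j).natDegree
  have hD : ∀ i j, (R i j).natDegree ≤ D := fun i j => by
    have h1 : (R i j).natDegree ≤ ∑ j, (R i j).natDegree :=
      Finset.single_le_sum (f := fun j => (R i j).natDegree) (fun _ _ => Nat.zero_le _)
        (Finset.mem_univ j)
    have h2 : ∑ j, (R i j).natDegree ≤ ∑ i, ∑ j, (R i j).natDegree :=
      Finset.single_le_sum (f := fun i => ∑ j, (R i j).natDegree) (fun _ _ => Nat.zero_le _)
        (Finset.mem_univ i)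
    omega
  have hDpos : 0 < D := by omega
  -- the lower central series slowed down by the factor `D`; truncated subtraction puts `V 0 = V 1`
  let V : ℕ → Subgroup G := fun j => (⊤ : Subgroup G).lowerCentralSeries ((j - 1) / D)
  have hVanti : Antitone V := fun a b hab =>
    Subgroup.lowerCentralSeries_antitone _ (Nat.div_le_div_right (by omega))
  obtain ⟨c, hcl⟩ := Subgroup.nilpotent_iff_lowerCentralSeries.1
    (inferInstance : Group.IsNilpotent G)
  have hVr : V (c * D + 1) = ⊥ := by
    simp only [V, Nat.add_sub_cancel, Nat.mul_div_cancel _ hDpos]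
    exact hcl
  have hVc : ∀ i j, ⁅V i, V j⁆ ≤ V (i + j) := by
    intro i j
    rcases Nat.eq_zero_or_pos i with rfl | hi
    · rw [zero_add]; exact Subgroup.commutator_le_right _ _
    rcases Nat.eq_zero_or_pos j with rfl | hj
    · exact Subgroup.commutator_le_left _ _
    refine (commutator_lowerCentralSeries_le _ _).trans
      (Subgroup.lowerCentralSeries_antitone _ ?_)
    have h1 := Nat.lt_div_mul_add (a := i - 1) hDpos
    have h2 := Nat.lt_div_mul_add (a := j - 1) hDpos
    refine Nat.le_of_lt_succ ((Nat.div_lt_iff_lt_mul hDpos).2 ?_)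
    simp only [Nat.succ_eq_add_one, add_mul]
    omega
  have hVtop : ∀ j ≤ D, V j = ⊤ := fun j hj => by
    simp only [V, Nat.div_eq_of_lt (show j - 1 < D by omega), Subgroup.lowerCentralSeries_zero]
  have hmul := isPolySeq_mul_and_commutator hVanti hVr hVc (c * D + 1) 0 (by omega)
  let P : ℕ → Subgroup (ℤ → G) := fun i =>
    { carrier := {u | IsPolySeq V i u}
      mul_mem' := fun hu hv => hmul.1 i (Nat.zero_le _) _ _ hu hv
      one_mem' := IsPolySeq.one i
      inv_mem' := fun hu => IsPolySeq.inv hu }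
  refine ⟨P, c * D + 1, ⟨fun i j hij u hu => IsPolySeq.anti hVanti hij hu, ?_, fun i u hu m =>
    IsPolySeq.seqDiff hu m⟩, fun j => ?_⟩
  · exact (Subgroup.eq_bot_iff_forall _).2 fun u hu => IsPolySeq.eq_one hVanti hVr le_rfl hu
  · have : (fun n => polynomialProduct T (fun i => p i j) n) =
        (List.ofFn fun i => (fun n : ℤ => T i ^ p i j n)).prod := by
      ext n
      rw [polynomialProduct, Pi.list_prod_apply, List.map_ofFn]
      rfl
    rw [this]
    refine Subgroup.list_prod_mem _ fun u hu => ?_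
    obtain ⟨i, rfl⟩ := List.mem_ofFn.1 hu
    exact isPolySeq_zpow hVtop (T i) (R i j) (hR i j) (hD i j)

end IntegerValued

/-! ### Reduction of systems of sequences -/

section Reduction

variable {G : Type*} [Group G] {ι : Type}

open Classical in
/-- The reduction of the system `g` along its member `g j` with step `m`. It keeps the members
different from `g j`, and adds the sequences `g j (n) (g j (n + m))⁻¹ h(n + m)`, where `h` is such a
member or `1`. The indices of all copies of `g j` are recycled for `h = 1`. -/
noncomputable def reduceSystem (g : ι → ℤ → G) (j : ι) (m : ℤ) : ι ⊕ ι → ℤ → G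
  | Sum.inl i => if g i = g j then g j * (seqShift m (g j))⁻¹ else g i
  | Sum.inr i => if g i = g j then g j * (seqShift m (g j))⁻¹
      else g j * (seqShift m (g j))⁻¹ * seqShift m (g i)

/-- For a chain `P`, the number of left cosets of `P (i + 1)` which meet both `g j * P i` and the
system `g` enlarged by the trivial sequence. -/
noncomputable def cosetCount (P : ℕ → Subgroup (ℤ → G)) (g : ι → ℤ → G) (j : ι) (i : ℕ) : ℕ :=
  ((QuotientGroup.mk : (ℤ → G) → (ℤ → G) ⧸ P (i + 1)) ''
    {x | (x = 1 ∨ ∃ a, g a = x) ∧ (g j)⁻¹ * x ∈ P i}).ncard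

/-- A member of a system along which it is worthwhile to reduce: it is nontrivial, and lies as high
in the chain as some member can, i.e. each group of the chain that contains it contains the whole
system. -/
structure IsPivot (P : ℕ → Subgroup (ℤ → G)) (g : ι → ℤ → G) (j : ι) : Prop where
  mem : ∀ i, g i ∈ P 0
  ne_one : g j ≠ 1
  mem_of_mem : ∀ a, g j ∈ P a → ∀ i, g i ∈ P a

variable {P : ℕ → Subgroup (ℤ → G)} {r : ℕ}

theorem finite_cosetCount_set [Finite ι] (g : ι → ℤ → G) (j : ι) (i : ℕ) :
    {x | (x = 1 ∨ ∃ a, g a = x) ∧ (g j)⁻¹ * x ∈ P i}.Finite :=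
  ((Set.finite_range g).insert 1).subset fun _ hx => hx.1

theorem cosetCount_le [Fintype ι] (g : ι → ℤ → G) (j : ι) (i : ℕ) :
    cosetCount P g j i ≤ Fintype.card ι + 1 := by
  refine (Set.ncard_image_le (finite_cosetCount_set g j i)).trans ?_
  have h1 : {x | (x = 1 ∨ ∃ a, g a = x) ∧ (g j)⁻¹ * x ∈ P i}.ncard ≤
      (insert 1 (Set.range g)).ncard :=
    Set.ncard_le_ncard (fun x hx => hx.1) ((Set.finite_range g).insert 1)
  refine h1.trans ((Set.ncard_insert_le _ _).trans ?_)
  have : (Set.range g).ncard ≤ Fintype.card ι := by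
    rw [← Set.image_univ, ← Nat.card_eq_fintype_card, ← Set.ncard_univ]
    exact Set.ncard_image_le Set.finite_univ
  omega

theorem IsDerivChain.seqShift_mem (hP : IsDerivChain P r) {i : ℕ} {u : ℤ → G} (hu : u ∈ P i)
    (m : ℤ) : seqShift m u ∈ P i := by
  rw [seqShift_eq]
  exact mul_mem hu (hP.anti (Nat.le_succ i) (hP.seqDiff_mem i u hu m))

theorem IsDerivChain.seqShift_mem_iff (hP : IsDerivChain P r) {i : ℕ} {u : ℤ → G} {m : ℤ} :
    seqShift m u ∈ P i ↔ u ∈ P i :=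
  ⟨fun h => by simpa [seqShift_neg_seqShift] using hP.seqShift_mem h (-m),
    fun h => hP.seqShift_mem h m⟩

theorem IsDerivChain.exists_isPivot (hP : IsDerivChain P r) {g : ι → ℤ → G}
    (h0 : ∀ i, g i ∈ P 0) (h1 : ∃ i, g i ≠ 1) : ∃ j, IsPivot P g j := by
  classical
  have hex : ∃ b, ∃ i, g i ∉ P b :=
    ⟨r, h1.imp fun i hi => by rwa [hP.eq_bot, Subgroup.mem_bot]⟩
  obtain ⟨j, hj⟩ := Nat.find_spec hex
  refine ⟨j, h0, fun h => hj (h ▸ one_mem _), fun a ha i => ?_⟩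
  by_contra hi
  exact hj (hP.anti (Nat.find_min' hex ⟨i, hi⟩) ha)

theorem pi_lex_of_le_of_lt {c c' : Fin r → ℕ} {e : Fin r} (hle : ∀ i ≤ e, c' i ≤ c i)
    (hlt : c' e < c e) : Pi.Lex (· < ·) (· < ·) c' c := by
  classical
  obtain ⟨i, hi, hmin⟩ := WellFounded.has_min (wellFounded_lt (α := Fin r)) {i | c' i < c i}
    ⟨e, hlt⟩
  have hie : i ≤ e := not_lt.1 (hmin e hlt)
  exact ⟨i, fun k hk => le_antisymm (hle k (hk.le.trans hie))
    (not_lt.1 fun h => hmin k h hk), hi⟩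

/-- The step of the PET induction: unless the reduced system is trivial, it has a pivot whose vector
of coset counts is lexicographically smaller. With a pivot `j'` of the reduced system which stays
as close to `g j` as possible, say `g' j' ∈ g j * P e`, the coset `g j * P (e + 1)` has disappeared
from the system, while the new members `g j * (seqShift m (g j))⁻¹ * seqShift m (g i)` lie in cosets
that were already present up to level `e`. -/
theorem IsPivot.exists_reduceSystem_lex [Finite ι] (hP : IsDerivChain P r) {g : ι → ℤ → G} {j : ι}
    (hj : IsPivot P g j) (m : ℤ) (hne : ∃ i, reduceSystem g j m i ≠ 1) :
    ∃ j', IsPivot P (reduceSystem g j m) j' ∧ Pi.Lex (· < ·) (· < ·)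
      (fun i : Fin r => cosetCount P (reduceSystem g j m) j' i)
      (fun i : Fin r => cosetCount P g j i) := by
  classical
  set g' := reduceSystem g j m with hg'
  -- `a` is the level of the pivot
  obtain ⟨a, ha, ha'⟩ : ∃ a, g j ∈ P a ∧ g j ∉ P (a + 1) := by
    have hex : ∃ b, g j ∉ P b := ⟨r, by rw [hP.eq_bot, Subgroup.mem_bot]; exact hj.ne_one⟩
    have h0 : Nat.find hex ≠ 0 := fun h => Nat.find_spec hex (h ▸ hj.mem j)
    obtain ⟨a, hfa⟩ := Nat.exists_eq_succ_of_ne_zero h0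
    refine ⟨a, not_not.1 (Nat.find_min hex (by omega)), ?_⟩
    have := Nat.find_spec hex
    rwa [hfa] at this
  have hall := hj.mem_of_mem a ha
  have hD : g j * (seqShift m (g j))⁻¹ ∈ P (a + 1) := by
    have := hP.seqDiff_mem a _ (inv_mem ha) m
    convert this using 1
    ext n; simp [seqShift, seqDiff]
  have hcases : ∀ i, g' i ∈ P (a + 1) ∨ (∃ b, g b ≠ g j ∧ g' i = g b) ∨
      ∃ b, g b ≠ g j ∧ g' i = g j * seqShift m ((g j)⁻¹ * g b) := by
    have hmul : ∀ b, g j * (seqShift m (g j))⁻¹ * seqShift m (g b) =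
        g j * seqShift m ((g j)⁻¹ * g b) := fun b => by
      ext n; simp [seqShift, mul_assoc]
    rintro (i | i) <;> by_cases h : g i = g j
    · left; simpa [hg', reduceSystem, h] using hD
    · right; left; exact ⟨i, h, by simp [hg', reduceSystem, h]⟩
    · left; simpa [hg', reduceSystem, h] using hD
    · right; right; exact ⟨i, h, by simp only [hg', reduceSystem, if_neg h, hmul]⟩
  have hall' : ∀ i, g' i ∈ P a := fun i => by
    rcases hcases i with h | ⟨b, -, h⟩ | ⟨b, -, h⟩
    · exact hP.anti (Nat.le_succ a) h
    · rw [h]; exact hall b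
    · rw [h]; exact mul_mem ha (hP.seqShift_mem (mul_mem (inv_mem ha) (hall b)) m)
  have hall0 : ∀ i, g' i ∈ P 0 := fun i => hP.anti (Nat.zero_le a) (hall' i)
  have hnot : ∀ i, g' i ≠ g j := fun i hi => by
    rcases hcases i with h | ⟨b, hb, h⟩ | ⟨b, hb, h⟩
    · exact ha' (hi ▸ h)
    · exact hb (h.symm.trans hi)
    · have h1 : seqShift m ((g j)⁻¹ * g b) = 1 := by
        rw [hi] at h; exact (mul_eq_left.1 h.symm)
      have h2 : (g j)⁻¹ * g b ∈ P r := by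
        rw [← hP.seqShift_mem_iff (m := m), h1]; exact one_mem _
      rw [hP.eq_bot, Subgroup.mem_bot, inv_mul_eq_one] at h2
      exact hb h2.symm
  -- `e` is the largest level at which the reduced system still meets `g j * P e`
  obtain ⟨e, ⟨i₀, hi₀, hi₀e⟩, hemax⟩ : ∃ e, (∃ i, g' i ≠ 1 ∧ (g j)⁻¹ * g' i ∈ P e) ∧
      ∀ i, g' i ≠ 1 → (g j)⁻¹ * g' i ∉ P (e + 1) := by
    have hex : ∃ b, ∀ i, g' i ≠ 1 → (g j)⁻¹ * g' i ∉ P b := ⟨r, fun i _ h => by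
      rw [hP.eq_bot, Subgroup.mem_bot, inv_mul_eq_one] at h
      exact hnot i h.symm⟩
    have h0 : Nat.find hex ≠ 0 := fun h => by
      obtain ⟨i, hi⟩ := hne
      exact Nat.find_spec hex i hi (h ▸ mul_mem (inv_mem (hj.mem j)) (hall0 i))
    obtain ⟨e, hfe⟩ := Nat.exists_eq_succ_of_ne_zero h0
    refine ⟨e, ?_, ?_⟩
    · have := Nat.find_min hex (m := e) (by omega)
      push Not at this
      exact this
    · have := Nat.find_spec hex
      rwa [hfe] at this
  have her : e < r := by
    by_contra h
    have := hP.anti (not_lt.1 h) hi₀e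
    rw [hP.eq_bot, Subgroup.mem_bot, inv_mul_eq_one] at this
    exact hnot i₀ this.symm
  have hae : a ≤ e := by
    by_contra h
    exact hemax i₀ hi₀ (hP.anti (show e + 1 ≤ a by omega) (mul_mem (inv_mem ha) (hall' i₀)))
  obtain ⟨j', hj', hj'e⟩ : ∃ j', IsPivot P g' j' ∧ (g j)⁻¹ * g' j' ∈ P e := by
    rcases hae.eq_or_lt with rfl | hlt
    · obtain ⟨j', hj'⟩ := hP.exists_isPivot hall0 hne
      exact ⟨j', hj', mul_mem (inv_mem ha) (hall' j')⟩
    · refine ⟨i₀, ⟨hall0, hi₀, fun b hb i => ?_⟩, hi₀e⟩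
      have hba : b ≤ a := by
        by_contra h
        apply ha'
        have h1 := mul_mem (hP.anti (show a + 1 ≤ b by omega) hb)
          (inv_mem (hP.anti (show a + 1 ≤ e by omega) hi₀e))
        simpa using h1
      exact hP.anti hba (hall' i)
  -- up to level `e`, the cosets of the old and the new pivot agree
  have hcoset : ∀ i ≤ e, ∀ x, (g' j')⁻¹ * x ∈ P i ↔ (g j)⁻¹ * x ∈ P i := fun i hi x => by
    have h := hP.anti hi hj'e
    have : (g j)⁻¹ * x = (g j)⁻¹ * g' j' * ((g' j')⁻¹ * x) := by group
    rw [this, Subgroup.mul_mem_cancel_left _ h]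
  have hsub : ∀ i ≤ e,
      (QuotientGroup.mk : (ℤ → G) → (ℤ → G) ⧸ P (i + 1)) ''
        {x | (x = 1 ∨ ∃ a, g' a = x) ∧ (g' j')⁻¹ * x ∈ P i} ⊆
      (QuotientGroup.mk : (ℤ → G) → (ℤ → G) ⧸ P (i + 1)) ''
        {x | (x = 1 ∨ ∃ a, g a = x) ∧ (g j)⁻¹ * x ∈ P i} := by
    rintro i hi _ ⟨x, ⟨hx, hxi⟩, rfl⟩
    rw [hcoset i hi] at hxi
    rcases hx with rfl | ⟨k, rfl⟩
    · exact ⟨1, ⟨Or.inl rfl, hxi⟩, rfl⟩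
    rcases hcases k with h | ⟨b, -, h⟩ | ⟨b, -, h⟩
    · have hia : i ≤ a := by
        by_contra hia
        apply ha'
        have h1 := mul_mem h (inv_mem (hP.anti (show a + 1 ≤ i by omega) hxi))
        simpa using h1
      refine ⟨1, ⟨Or.inl rfl, by simpa using hP.anti hia ha⟩, ?_⟩
      rw [QuotientGroup.eq]
      simpa using hP.anti (show i + 1 ≤ a + 1 by omega) h
    · exact ⟨g b, ⟨Or.inr ⟨b, rfl⟩, by rwa [← h]⟩, by rw [h]⟩
    · rw [h] at hxi ⊢
      rw [inv_mul_cancel_left, hP.seqShift_mem_iff] at hxi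
      refine ⟨g b, ⟨Or.inr ⟨b, rfl⟩, hxi⟩, ?_⟩
      rw [QuotientGroup.eq]
      convert hP.seqDiff_mem i _ hxi m using 1
      ext n; simp [seqShift, seqDiff, mul_assoc]
  refine ⟨j', hj', pi_lex_of_le_of_lt (e := ⟨e, her⟩) (fun i hi => ?_) ?_⟩
  · exact Set.ncard_le_ncard (hsub i hi) ((finite_cosetCount_set g j i).image _)
  · refine Set.ncard_lt_ncard ((hsub e le_rfl).ssubset_of_mem_notMem
      (a := (QuotientGroup.mk (g j))) ⟨g j, ⟨Or.inr ⟨j, rfl⟩, by simp⟩, rfl⟩ ?_)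
      ((finite_cosetCount_set g j e).image _)
    rintro ⟨x, ⟨hx, -⟩, hxe⟩
    rw [eq_comm, QuotientGroup.eq] at hxe
    have hx1 : x ≠ 1 := by
      rintro rfl
      exact ha' (hP.anti (show a + 1 ≤ e + 1 by omega) (by simpa using hxe))
    rcases hx with rfl | ⟨k, rfl⟩
    · exact hx1 rfl
    · exact hemax k hx1 hxe

end Reduction

/-! ### Convergence along an ultrafilter of parameters -/

section Ultra

open Filter Topology

variable {p : Ultrafilter ℕ}

theorem Ultrafilter.exists_eventually_of_finite {κ : Type*} {S : Set κ} (hS : S.Finite)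
    {Q : κ → ℕ → Prop} (h : ∀ᶠ k in p, ∃ t ∈ S, Q t k) : ∃ t ∈ S, ∀ᶠ k in p, Q t k := by
  by_contra! hcon
  have h1 : ∀ᶠ k in p, ∀ t ∈ S, ¬ Q t k :=
    (eventually_all_finite hS).2 hcon
  obtain ⟨k, ⟨t, ht, hk⟩, hk'⟩ := (h.and h1).exists
  exact hk' t ht hk

/-- A countable saturation property: a property of `k` which depends on a parameter `N` and can be
met with arbitrarily large fixed `N` can be met with a parameter `n k` tending to infinity. -/
theorem exists_diagonal (hp : (p : Filter ℕ) ≤ atTop) {Q : ℕ → ℕ → Prop}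
    (h : ∀ M, ∃ N ≥ M, ∀ᶠ k in p, Q N k) :
    ∃ n : ℕ → ℕ, Tendsto n p atTop ∧ ∀ᶠ k in p, Q (n k) k := by
  classical
  have key : ∀ M, ∀ᶠ k in p, M ≤ Nat.findGreatest (fun N => Q N k) k ∧
      Q (Nat.findGreatest (fun N => Q N k) k) k := fun M => by
    obtain ⟨N, hN, hQ⟩ := h M
    filter_upwards [hQ, hp (eventually_ge_atTop N)] with k hk hkN
    exact ⟨hN.trans (Nat.le_findGreatest hkN hk),
      Nat.findGreatest_spec (P := fun N => Q N k) hkN hk⟩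
  exact ⟨fun k => Nat.findGreatest (fun N => Q N k) k,
    tendsto_atTop.2 fun M => (key M).mono fun k hk => hk.1, (key 0).mono fun k hk => hk.2⟩

/-- The sequence `N ↦ a N k`, with a parameter `k` running along the ultrafilter `p`, is Cauchy as a
sequence in the ultraproduct. For a constant family this is the usual Cauchy property; in general
it amounts to metastability of the sequences `a · k`, uniformly in `k`. -/
def UltraCauchy {E : Type*} [SeminormedAddCommGroup E] (p : Ultrafilter ℕ) (a : ℕ → ℕ → E) : Prop :=
  ∀ ε > 0, ∃ M, ∀ N ≥ M, ∀ N' ≥ M, ∀ᶠ k in p, ‖a N k - a N' k‖ ≤ ε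

section Cauchy

variable {E : Type*} [SeminormedAddCommGroup E] {a b : ℕ → ℕ → E}

theorem UltraCauchy.of_approx (h : ∀ ε > 0, ∃ b, UltraCauchy p b ∧
    ∃ M, ∀ N ≥ M, ∀ᶠ k in p, ‖a N k - b N k‖ ≤ ε) : UltraCauchy p a := by
  intro ε hε
  obtain ⟨b, hb, M₁, hM₁⟩ := h (ε / 3) (by positivity)
  obtain ⟨M₂, hM₂⟩ := hb (ε / 3) (by positivity)
  refine ⟨max M₁ M₂, fun N hN N' hN' => ?_⟩
  filter_upwards [hM₁ N (le_of_max_le_left hN), hM₁ N' (le_of_max_le_left hN'),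
    hM₂ N (le_of_max_le_right hN) N' (le_of_max_le_right hN')] with k h1 h2 h3
  have : a N k - a N' k = (a N k - b N k) + (b N k - b N' k) - (a N' k - b N' k) := by abel
  rw [this]
  have h4 := norm_sub_le (a N k - b N k + (b N k - b N' k)) (a N' k - b N' k)
  have h5 := norm_add_le (a N k - b N k) (b N k - b N' k)
  linarith

theorem UltraCauchy.congr (hb : UltraCauchy p b)
    (h : ∀ N ≥ 1, ∀ᶠ k in p, a N k = b N k) : UltraCauchy p a :=
  UltraCauchy.of_approx fun ε hε => ⟨b, hb, 1, fun N hN => (h N hN).mono fun k hk => by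
    rw [hk, sub_self, norm_zero]; exact hε.le⟩

theorem UltraCauchy.of_const (c : ℕ → E) : UltraCauchy p fun _ k => c k :=
  fun ε hε => ⟨0, fun _ _ _ _ => .of_forall fun k => by simpa using hε.le⟩

theorem UltraCauchy.add (ha : UltraCauchy p a) (hb : UltraCauchy p b) :
    UltraCauchy p fun N k => a N k + b N k := by
  intro ε hε
  obtain ⟨M₁, hM₁⟩ := ha (ε / 2) (by positivity)
  obtain ⟨M₂, hM₂⟩ := hb (ε / 2) (by positivity)
  refine ⟨max M₁ M₂, fun N hN N' hN' => ?_⟩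
  filter_upwards [hM₁ N (le_of_max_le_left hN) N' (le_of_max_le_left hN'),
    hM₂ N (le_of_max_le_right hN) N' (le_of_max_le_right hN')] with k h1 h2
  rw [add_sub_add_comm]
  have := norm_add_le (a N k - a N' k) (b N k - b N' k)
  linarith

theorem UltraCauchy.smul {𝕜 : Type*} [NormedField 𝕜] [NormedSpace 𝕜 E] (ha : UltraCauchy p a)
    (c : 𝕜) : UltraCauchy p fun N k => c • a N k := by
  intro ε hε
  obtain ⟨M, hM⟩ := ha (ε / (‖c‖ + 1)) (by positivity)
  refine ⟨M, fun N hN N' hN' => (hM N hN N' hN').mono fun k hk => ?_⟩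
  rw [← smul_sub, norm_smul]
  rw [le_div_iff₀ (by positivity)] at hk
  nlinarith [norm_nonneg c, norm_nonneg (a N k - a N' k)]

end Cauchy

theorem exists_tendsto_of_mem_Icc {u : ℕ → ℝ} {C : ℝ} (hu : ∀ k, u k ∈ Set.Icc 0 C) :
    ∃ L ∈ Set.Icc 0 C, Tendsto u p (𝓝 L) := by
  obtain ⟨L, hL, hLe⟩ := isCompact_Icc.ultrafilter_le_nhds (p.map u)
    (le_principal_iff.2 (mem_map.2 (univ_mem' hu)))
  exact ⟨L, hL, hLe⟩

/-- An integrated form of Egorov's theorem: if for each `i` the average over `n < N k` of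
`ψ i k n` exceeds `ε`, then a single choice `n k` witnesses large values for infinitely many `i`.
Windows `[j, j + s j]` are chosen so long that extending them does not increase the average of the
maximum over the window by more than a small summable error. -/
theorem exists_choice_of_lt_average (hp : (p : Filter ℕ) ≤ atTop) {N : ℕ → ℕ}
    {ψ : ℕ → ℕ → ℕ → ℝ} {C ε : ℝ} (hε : 0 < ε) (h0 : ∀ i k n, 0 ≤ ψ i k n)
    (hC : ∀ i k n, ψ i k n ≤ C)
    (h : ∀ i, ∀ᶠ k in p, ε < (N k : ℝ)⁻¹ * ∑ n ∈ Finset.range (N k), ψ i k n) :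
    ∃ n : ℕ → ℕ, ∀ j, ∃ i ≥ j, ∀ᶠ k in p, ε / 4 < ψ i k (n k) := by
  classical
  let W : ℕ → ℕ → ℕ → ℕ → ℝ := fun j s k n =>
    (Finset.range (s + 1)).sup' Finset.nonempty_range_add_one fun t => ψ (j + t) k n
  have hWle : ∀ j s k n i, j ≤ i → i ≤ j + s → ψ i k n ≤ W j s k n := fun j s k n i h1 h2 => by
    have := Finset.le_sup' (fun t => ψ (j + t) k n) (Finset.mem_range.2 (show i - j < s + 1 by omega))
    simpa [Nat.add_sub_cancel' h1] using this
  have hWmono : ∀ j s s' k n, s ≤ s' → W j s k n ≤ W j s' k n := fun j s s' k n hs =>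
    Finset.sup'_mono _ (Finset.range_mono (by omega)) _
  have hWC : ∀ j s k n, W j s k n ≤ C := fun j s k n => Finset.sup'_le _ _ fun t _ => hC _ _ _
  have hW0 : ∀ j s k n, 0 ≤ W j s k n := fun j s k n =>
    (h0 j k n).trans (hWle j s k n j le_rfl (by omega))
  have hC0 : 0 ≤ C := (h0 0 0 0).trans (hC 0 0 0)
  let F : ℕ → ℕ → ℕ → ℝ := fun j s k => (N k : ℝ)⁻¹ * ∑ n ∈ Finset.range (N k), W j s k n
  have hF : ∀ j s k, F j s k ∈ Set.Icc 0 C := fun j s k => by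
    refine ⟨mul_nonneg (by positivity) (Finset.sum_nonneg fun n _ => hW0 _ _ _ _), ?_⟩
    have h1 : ∑ n ∈ Finset.range (N k), W j s k n ≤ N k * C := by
      simpa using Finset.sum_le_card_nsmul (Finset.range (N k)) _ C fun n _ => hWC j s k n
    rcases Nat.eq_zero_or_pos (N k) with hN | hN
    · simpa [F, hN] using hC0
    · have hN' : (0 : ℝ) < N k := by exact_mod_cast hN
      exact (inv_mul_le_iff₀ hN').2 h1
  have hFmono : ∀ j s s' k, s ≤ s' → F j s k ≤ F j s' k := fun j s s' k hs =>
    mul_le_mul_of_nonneg_left (Finset.sum_le_sum fun n _ => hWmono j s s' k n hs) (by positivity)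
  choose L hL hFL using fun j s => exists_tendsto_of_mem_Icc (p := p) (hF j s)
  have hwin : ∀ j, ∃ s, ∀ s' ≥ s, ∀ᶠ k in p, F j s' k ≤ F j s k + ε / 4 * (1 / 2) ^ j := by
    intro j
    have hη : 0 < ε / 4 * (1 / 2 : ℝ) ^ j := by positivity
    have hbdd : BddAbove (Set.range (L j)) := ⟨C, by rintro _ ⟨s, rfl⟩; exact (hL j s).2⟩
    obtain ⟨s, hs⟩ := exists_lt_of_lt_ciSup (sub_lt_self (⨆ s, L j s) hη)
    refine ⟨s, fun s' _ => ?_⟩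
    have h1 : L j s' < L j s + ε / 4 * (1 / 2) ^ j := by
      have := le_ciSup hbdd s'
      linarith
    exact ((hFL j s').eventually_lt ((hFL j s).add_const _) h1).mono fun k hk => hk.le
  choose s hs using hwin
  have hgood : ∀ J, ∀ᶠ k in p, ∃ n, ∀ j ≤ J, ε / 4 < W j (s j) k n := by
    intro J
    set S := J + ∑ j ∈ Finset.range (J + 1), s j with hS
    have hsS : ∀ j ∈ Finset.range (J + 1), s j ≤ S := fun j hj =>
      (Finset.single_le_sum (f := s) (fun _ _ => Nat.zero_le _) hj).trans (Nat.le_add_left _ _)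
    have hev : ∀ᶠ k in p, ∀ j ∈ Finset.range (J + 1),
        F j S k ≤ F j (s j) k + ε / 4 * (1 / 2) ^ j :=
      (eventually_all_finset _).2 fun j hj => hs j S (hsS j hj)
    filter_upwards [hev, h J] with k hk hkJ
    have hN : (0 : ℝ) < N k := by
      rcases Nat.eq_zero_or_pos (N k) with hN | hN
      · rw [hN] at hkJ; simp at hkJ; linarith
      · exact_mod_cast hN
    let D : ℕ → ℝ := fun n => ∑ j ∈ Finset.range (J + 1), (W j S k n - W j (s j) k n)
    have hgeom : ∑ j ∈ Finset.range (J + 1), ε / 4 * (1 / 2 : ℝ) ^ j ≤ ε / 2 := by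
      rw [← Finset.mul_sum]
      have := sum_geometric_two_le (J + 1)
      nlinarith
    have hDavg : (N k : ℝ)⁻¹ * ∑ n ∈ Finset.range (N k), D n ≤ ε / 2 := by
      have h1 : (N k : ℝ)⁻¹ * ∑ n ∈ Finset.range (N k), D n =
          ∑ j ∈ Finset.range (J + 1), (F j S k - F j (s j) k) := by
        simp only [D, F]
        rw [Finset.sum_comm, Finset.mul_sum]
        exact Finset.sum_congr rfl fun j _ => by rw [Finset.sum_sub_distrib, mul_sub]
      rw [h1]
      refine (Finset.sum_le_sum fun j hj => ?_).trans hgeom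
      linarith [hk j hj]
    obtain ⟨n, -, hn⟩ : ∃ n ∈ Finset.range (N k), ε / 2 < ψ J k n - D n := by
      by_contra! hcon
      have h1 := Finset.sum_le_sum hcon
      rw [Finset.sum_sub_distrib, Finset.sum_const, Finset.card_range, nsmul_eq_mul] at h1
      have h2 := mul_le_mul_of_nonneg_left h1 (inv_nonneg.2 hN.le)
      rw [mul_sub, inv_mul_cancel_left₀ hN.ne'] at h2
      linarith
    refine ⟨n, fun j hj => ?_⟩
    have hjJ : j ∈ Finset.range (J + 1) := Finset.mem_range.2 (by omega)
    have h1 : W j S k n - W j (s j) k n ≤ D n :=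
      Finset.single_le_sum (f := fun j => W j S k n - W j (s j) k n)
        (fun i hi => sub_nonneg.2 (hWmono i _ _ k n (hsS i hi))) hjJ
    have h2 := hWle j S k n J hj (by omega)
    linarith
  obtain ⟨J, hJ, hJQ⟩ := exists_diagonal hp
    (Q := fun J k => ∃ n, ∀ j ≤ J, ε / 4 < W j (s j) k n) fun M => ⟨M, le_rfl, hgood M⟩
  have : ∀ k, ∃ n, (∃ n, ∀ j ≤ J k, ε / 4 < W j (s j) k n) → ∀ j ≤ J k, ε / 4 < W j (s j) k n :=
    fun k => by
      by_cases hk : ∃ n, ∀ j ≤ J k, ε / 4 < W j (s j) k n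
      · exact hk.imp fun n hn _ => hn
      · exact ⟨0, fun h => absurd h hk⟩
  choose n hn using this
  refine ⟨n, fun j => ?_⟩
  have hex : ∀ᶠ k in p, ∃ t ∈ (Finset.range (s j + 1) : Set ℕ), ε / 4 < ψ (j + t) k (n k) := by
    filter_upwards [hJQ, hJ.eventually_ge_atTop j] with k hk hkj
    obtain ⟨t, ht, htk⟩ := (Finset.lt_sup'_iff _).1 (hn k hk j hkj)
    exact ⟨t, Finset.mem_coe.2 ht, htk⟩
  obtain ⟨t, -, ht⟩ := Ultrafilter.exists_eventually_of_finite (Finset.finite_toSet _) hex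
  exact ⟨j + t, Nat.le_add_right _ _, ht⟩

/-- Averages over `n < N k` of a family which is Cauchy for each choice `n k` are Cauchy. -/
theorem UltraCauchy.average {𝕜 E : Type*} [RCLike 𝕜] [SeminormedAddCommGroup E] [NormedSpace 𝕜 E]
    (hp : (p : Filter ℕ) ≤ atTop) (N : ℕ → ℕ) {a : ℕ → ℕ → ℕ → E} {C : ℝ}
    (hC : ∀ M k n, ‖a M k n‖ ≤ C) (h : ∀ n : ℕ → ℕ, UltraCauchy p fun M k => a M k (n k)) :
    UltraCauchy p fun M k => (N k : 𝕜)⁻¹ • ∑ n ∈ Finset.range (N k), a M k n := by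
  by_contra hcon
  simp only [UltraCauchy, not_forall, not_exists] at hcon
  obtain ⟨ε, hε, hcon⟩ := hcon
  choose A hA B hB hAB using hcon
  obtain ⟨n, hn⟩ := exists_choice_of_lt_average hp (N := N)
    (ψ := fun i k n => ‖a (A i) k n - a (B i) k n‖) (C := C + C) hε
    (fun _ _ _ => norm_nonneg _)
    (fun i k n => (norm_sub_le _ _).trans (add_le_add (hC _ _ _) (hC _ _ _))) (fun i => by
      refine (Ultrafilter.eventually_not.2 (hAB i)).mono fun k hk => (not_le.1 hk).trans_le ?_
      rw [← smul_sub, ← Finset.sum_sub_distrib, norm_smul, norm_inv, RCLike.norm_natCast]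
      exact mul_le_mul_of_nonneg_left (norm_sum_le _ _) (by positivity))
  obtain ⟨M, hM⟩ := h n (ε / 4) (by positivity)
  obtain ⟨i, hi, hik⟩ := hn M
  obtain ⟨k, h1, h2⟩ := (hik.and (hM (A i) (le_trans hi (hA i)) (B i) (le_trans hi (hB i)))).exists
  exact absurd h1 (not_lt.2 h2)

end Ultra

/-! ### Averages of bounded functions under a group action -/

section Action

open Filter Topology

theorem norm_average_le {𝕜 V : Type*} [RCLike 𝕜] [SeminormedAddCommGroup V]
    [NormedSpace 𝕜 V] {v : ℕ → V} {N : ℕ} {C : ℝ} (hC : 0 ≤ C) (hv : ∀ n, ‖v n‖ ≤ C) :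
    ‖(N : 𝕜)⁻¹ • ∑ n ∈ Finset.range N, v n‖ ≤ C := by
  rw [norm_smul, norm_inv, RCLike.norm_natCast]
  have h1 : ‖∑ n ∈ Finset.range N, v n‖ ≤ N * C := by
    simpa using (norm_sum_le _ _).trans
      (Finset.sum_le_card_nsmul (Finset.range N) _ C fun n _ => hv n)
  rcases Nat.eq_zero_or_pos N with hN | hN
  · simpa [hN] using hC
  · exact (inv_mul_le_iff₀ (by exact_mod_cast hN)).2 h1

theorem norm_prod_le_pow {B κ : Type*} [NormedCommRing B] [NormOneClass B] [Fintype κ]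
    {v : κ → B} {C : ℝ}
    (hv : ∀ i, ‖v i‖ ≤ C) : ‖∏ i, v i‖ ≤ C ^ Fintype.card κ := by
  refine (Finset.norm_prod_le _ _).trans ?_
  simpa using Finset.prod_le_prod (s := Finset.univ) (fun i _ => norm_nonneg (v i))
    fun i _ => hv i

theorem norm_sum_shift_sub_le {V : Type*} [SeminormedAddCommGroup V] {v : ℕ → V} {C : ℝ}
    (hv : ∀ n, ‖v n‖ ≤ C) (m N : ℕ) :
    ‖∑ n ∈ Finset.range N, v (m + n) - ∑ n ∈ Finset.range N, v n‖ ≤ m * (2 * C) := by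
  have h1 := Finset.sum_range_add v m N
  have h2 := Finset.sum_range_add v N m
  rw [add_comm N m, h1] at h2
  have h3 : ∑ n ∈ Finset.range N, v (m + n) - ∑ n ∈ Finset.range N, v n =
      ∑ n ∈ Finset.range m, (v (N + n) - v n) := by
    rw [Finset.sum_sub_distrib, sub_eq_sub_iff_add_eq_add, add_comm, h2, add_comm]
  rw [h3]
  refine (norm_sum_le _ _).trans ?_
  have := Finset.sum_le_card_nsmul (Finset.range m) (fun n => ‖v (N + n) - v n‖) (2 * C)
    fun n _ => (norm_sub_le _ _).trans (by linarith [hv (N + n), hv n])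
  simpa using this

/-- A group `H` acting by trace preserving automorphisms on a commutative algebra `B` of bounded
functions, recorded through the inner product space `E` of square integrable functions: `B` carries
the supremum norm, and `toL2` maps it to `E`. -/
structure L2Action (𝕜 H B E : Type*) [RCLike 𝕜] [Group H] [NormedCommRing B] [NormedAlgebra 𝕜 B]
    [NormedAddCommGroup E] [InnerProductSpace 𝕜 E] where
  /-- A bounded function, viewed as a square integrable one. -/
  toL2 : B →ₗ[𝕜] E
  /-- Pointwise complex conjugation. -/
  conj : B →* B
  /-- The action of the group. -/
  act : H →* (B →ₐ[𝕜] B)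
  norm_toL2_le : ∀ f, ‖toL2 f‖ ≤ ‖f‖
  norm_toL2_mul_le : ∀ f h, ‖toL2 (f * h)‖ ≤ ‖f‖ * ‖toL2 h‖
  norm_conj_le : ∀ f, ‖conj f‖ ≤ ‖f‖
  norm_act_le : ∀ g f, ‖act g f‖ ≤ ‖f‖
  conj_act : ∀ g f, conj (act g f) = act g (conj f)
  inner_mul_left : ∀ f h k, inner 𝕜 (toL2 (f * h)) (toL2 k) = inner 𝕜 (toL2 h) (toL2 (conj f * k))
  inner_act : ∀ g f h, inner 𝕜 (toL2 (act g f)) (toL2 (act g h)) = inner 𝕜 (toL2 f) (toL2 h)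

variable {𝕜 H B E : Type*} [RCLike 𝕜] [Group H] [NormedCommRing B] [NormedAlgebra 𝕜 B]
  [NormedAddCommGroup E] [InnerProductSpace 𝕜 E]

namespace L2Action

variable (A : L2Action 𝕜 H B E) {p : Ultrafilter ℕ}

theorem act_inv_act (g : H) (f : B) : A.act g⁻¹ (A.act g f) = f := by
  rw [← AlgHom.mul_apply, ← map_mul, inv_mul_cancel, map_one, AlgHom.one_apply]

theorem norm_toL2_act (g : H) (f : B) : ‖A.toL2 (A.act g f)‖ = ‖A.toL2 f‖ := by
  rw [@norm_eq_sqrt_re_inner 𝕜, @norm_eq_sqrt_re_inner 𝕜, A.inner_act]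

theorem inner_act_left (g : H) (f h : B) :
    inner 𝕜 (A.toL2 (A.act g f)) (A.toL2 h) = inner 𝕜 (A.toL2 f) (A.toL2 (A.act g⁻¹ h)) := by
  rw [← A.inner_act g⁻¹, A.act_inv_act]

/-- The average over `n < N` of the functions `F n * act (U n) u`, as a linear function of `u`. -/
noncomputable def weightedAverage (F : ℤ → B) (U : ℤ → H) (N : ℕ) : B →ₗ[𝕜] B :=
  (N : 𝕜)⁻¹ • ∑ n ∈ Finset.range N, LinearMap.mulLeft 𝕜 (F n) ∘ₗ (A.act (U n)).toLinearMap

theorem weightedAverage_apply (F : ℤ → B) (U : ℤ → H) (N : ℕ) (u : B) :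
    A.weightedAverage F U N u =
      (N : 𝕜)⁻¹ • ∑ n ∈ Finset.range N, F n * A.act (U n) u := by
  simp [weightedAverage]

/-- The average over `n < N` of `act (U n)⁻¹ (conj (F n) * b)`. In `L²` this is the value at `b` of
the adjoint of `weightedAverage F U N`. -/
noncomputable def dualAverage (F : ℤ → B) (U : ℤ → H) (N : ℕ) (b : B) : B :=
  (N : 𝕜)⁻¹ • ∑ n ∈ Finset.range N, A.act (U n)⁻¹ (A.conj (F n) * b)

theorem norm_weightedAverage_le {F : ℤ → B} {U : ℤ → H} {N : ℕ} {u : B} {K C : ℝ}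
    (hF : ∀ n, ‖F n‖ ≤ K) (hu : ‖u‖ ≤ C) : ‖A.weightedAverage F U N u‖ ≤ K * C := by
  have hK := (norm_nonneg _).trans (hF 0)
  have hC := (norm_nonneg _).trans hu
  rw [weightedAverage_apply]
  exact norm_average_le (by positivity) fun n => (norm_mul_le _ _).trans
    (mul_le_mul (hF n) ((A.norm_act_le _ _).trans hu) (norm_nonneg _) hK)

theorem norm_act_conj_mul_le {F : ℤ → B} (U : ℤ → H) {b : B} {K C : ℝ}
    (hF : ∀ n, ‖F n‖ ≤ K) (hb : ‖b‖ ≤ C) (n : ℤ) :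
    ‖A.act (U n)⁻¹ (A.conj (F n) * b)‖ ≤ K * C :=
  (A.norm_act_le _ _).trans ((norm_mul_le _ _).trans (mul_le_mul
    ((A.norm_conj_le _).trans (hF n)) hb (norm_nonneg _) ((norm_nonneg _).trans (hF 0))))

theorem norm_dualAverage_le {F : ℤ → B} {U : ℤ → H} {N : ℕ} {b : B} {K C : ℝ}
    (hF : ∀ n, ‖F n‖ ≤ K) (hb : ‖b‖ ≤ C) : ‖A.dualAverage F U N b‖ ≤ K * C := by
  have hK := (norm_nonneg _).trans (hF 0)
  have hC := (norm_nonneg _).trans hb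
  exact norm_average_le (by positivity) fun n => A.norm_act_conj_mul_le U hF hb n

theorem norm_toL2_dualAverage_le {F : ℤ → B} {U : ℤ → H} {N : ℕ} {b : B} {K : ℝ}
    (hF : ∀ n, ‖F n‖ ≤ K) : ‖A.toL2 (A.dualAverage F U N b)‖ ≤ K * ‖A.toL2 b‖ := by
  have hK := (norm_nonneg _).trans (hF 0)
  rw [dualAverage, map_smul, map_sum]
  refine norm_average_le (by positivity) fun n => ?_
  rw [A.norm_toL2_act]
  exact (A.norm_toL2_mul_le _ _).trans (mul_le_mul_of_nonneg_right
    ((A.norm_conj_le _).trans (hF n)) (norm_nonneg _))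

theorem inner_weightedAverage (F : ℤ → B) (U : ℤ → H) (N : ℕ) (u b : B) :
    inner 𝕜 (A.toL2 (A.weightedAverage F U N u)) (A.toL2 b) =
      inner 𝕜 (A.toL2 u) (A.toL2 (A.dualAverage F U N b)) := by
  rw [weightedAverage_apply, dualAverage, map_smul, map_smul, map_sum, map_sum, inner_smul_left,
    inner_smul_right, sum_inner, inner_sum]
  congr 1
  · simp
  · exact Finset.sum_congr rfl fun n _ => by rw [A.inner_mul_left, A.inner_act_left]

/-- If weighted averages converge on all dual averages of unbounded length, they converge on all
bounded functions. The functions on which they converge form a space `𝒞`. If `φ ∈ 𝒞` is almost as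
close to `u` as possible, then `u - φ` is almost orthogonal to the dual averages. As
`‖weightedAverage (u - φ)‖ ^ 2` is the inner product of `u - φ` with a dual average, the weighted
averages of `u - φ` are small in the limit. -/
theorem ultraCauchy_weightedAverage (hp : (p : Filter ℕ) ≤ atTop) {F : ℕ → ℤ → B} {U : ℕ → ℤ → H}
    {K : ℝ} (hK : 1 ≤ K) (hF : ∀ k n, ‖F k n‖ ≤ K)
    (hdual : ∀ N : ℕ → ℕ, Tendsto N p atTop → ∀ (C : ℝ) (b : ℕ → B), (∀ k, ‖b k‖ ≤ C) →
      UltraCauchy p fun M k => A.toL2 (A.weightedAverage (F k) (U k) M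
        (A.dualAverage (F k) (U k) (N k) (b k))))
    {C : ℝ} {u : ℕ → B} (hu : ∀ k, ‖u k‖ ≤ C) :
    UltraCauchy p fun M k => A.toL2 (A.weightedAverage (F k) (U k) M (u k)) := by
  let 𝒞 : Set (ℕ → B) := {φ | (∃ C, ∀ k, ‖φ k‖ ≤ C) ∧
    UltraCauchy p fun M k => A.toL2 (A.weightedAverage (F k) (U k) M (φ k))}
  let Λ : Set ℝ := {L | ∃ φ ∈ 𝒞, ∀ᶠ k in p, ‖A.toL2 (u k - φ k)‖ ^ 2 ≤ L}
  have hΛ0 : ∀ L ∈ Λ, 0 ≤ L := by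
    rintro L ⟨φ, -, h⟩
    obtain ⟨k, hk⟩ := h.exists
    exact (sq_nonneg _).trans hk
  have hΛbdd : BddBelow Λ := ⟨0, hΛ0⟩
  have hΛne : Λ.Nonempty := by
    refine ⟨C ^ 2, 0, ⟨⟨0, fun k => by simp⟩, ?_⟩, .of_forall fun k => ?_⟩
    · simpa using UltraCauchy.of_const (p := p) (0 : ℕ → E)
    · rw [Pi.zero_apply, sub_zero]
      exact pow_le_pow_left₀ (norm_nonneg _) ((A.norm_toL2_le _).trans (hu k)) 2
  refine UltraCauchy.of_approx fun ε hε => ?_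
  have hK0 : 0 < K := by linarith
  obtain ⟨L, ⟨φ, ⟨⟨Cφ, hφC⟩, hφ⟩, hφL⟩, hL⟩ := exists_lt_of_csInf_lt hΛne
    (lt_add_of_pos_right (sInf Λ) (show 0 < ε ^ 2 / K ^ 2 by positivity))
  refine ⟨_, hφ, ?_⟩
  have hsub : ∀ N k, A.toL2 (A.weightedAverage (F k) (U k) N (u k)) -
      A.toL2 (A.weightedAverage (F k) (U k) N (φ k)) =
      A.toL2 (A.weightedAverage (F k) (U k) N (u k - φ k)) := fun N k => by
    rw [← map_sub, ← map_sub]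
  simp only [hsub]
  by_contra! hcon
  obtain ⟨N, hN, hNε⟩ := exists_diagonal hp
    (Q := fun N k => ε < ‖A.toL2 (A.weightedAverage (F k) (U k) N (u k - φ k))‖) fun M => by
      obtain ⟨N, hN, h⟩ := hcon M
      exact ⟨N, hN, h⟩
  set b : ℕ → B := fun k => A.weightedAverage (F k) (U k) (N k) (u k - φ k) with hb
  have hbC : ∀ k, ‖b k‖ ≤ K * (C + Cφ) := fun k =>
    A.norm_weightedAverage_le (hF k) ((norm_sub_le _ _).trans (add_le_add (hu k) (hφC k)))
  set σ : ℕ → B := fun k => A.dualAverage (F k) (U k) (N k) (b k) with hσ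
  -- subtracting `(K ^ 2)⁻¹ • σ` brings `u - φ` closer to zero by a definite amount
  have hmem : L - ε ^ 2 / K ^ 2 ∈ Λ := by
    refine ⟨fun k => φ k + ((K ^ 2 : ℝ) : 𝕜)⁻¹ • σ k, ⟨⟨Cφ + ‖((K ^ 2 : ℝ) : 𝕜)⁻¹‖ *
      (K * (K * (C + Cφ))), fun k => ?_⟩, ?_⟩, ?_⟩
    · refine (norm_add_le _ _).trans (add_le_add (hφC k) ?_)
      rw [norm_smul]
      exact mul_le_mul_of_nonneg_left (A.norm_dualAverage_le (hF k) (hbC k)) (norm_nonneg _)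
    · simpa only [map_add, map_smul] using hφ.add ((hdual N hN _ b hbC).smul ((K ^ 2 : ℝ) : 𝕜)⁻¹)
    · filter_upwards [hφL, hNε] with k hk hkε
      have h1 : RCLike.re (inner 𝕜 (A.toL2 (u k - φ k)) (A.toL2 (σ k))) = ‖A.toL2 (b k)‖ ^ 2 := by
        rw [hσ, ← A.inner_weightedAverage, inner_self_eq_norm_sq]
      have h2 : ‖A.toL2 (σ k)‖ ≤ K * ‖A.toL2 (b k)‖ := A.norm_toL2_dualAverage_le (hF k)
      have h3 : u k - (φ k + ((K ^ 2 : ℝ) : 𝕜)⁻¹ • σ k) =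
          (u k - φ k) - ((K ^ 2 : ℝ) : 𝕜)⁻¹ • σ k := by abel
      have h4 : ‖((K ^ 2 : ℝ) : 𝕜)⁻¹‖ = (K ^ 2)⁻¹ := by
        rw [norm_inv, RCLike.norm_ofReal, abs_of_nonneg (by positivity)]
      rw [h3, map_sub, map_smul, @norm_sub_sq 𝕜, inner_smul_right, norm_smul, h4,
        ← RCLike.ofReal_inv, RCLike.re_ofReal_mul, h1]
      have h5 : ε ^ 2 ≤ ‖A.toL2 (b k)‖ ^ 2 := pow_le_pow_left₀ hε.le hkε.le 2
      have h6 : ((K ^ 2)⁻¹ * ‖A.toL2 (σ k)‖) ^ 2 ≤ (K ^ 2)⁻¹ * ‖A.toL2 (b k)‖ ^ 2 := by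
        have h7 : ‖A.toL2 (σ k)‖ ^ 2 ≤ K ^ 2 * ‖A.toL2 (b k)‖ ^ 2 := by
          rw [← mul_pow]; exact pow_le_pow_left₀ (norm_nonneg _) h2 2
        calc ((K ^ 2)⁻¹ * ‖A.toL2 (σ k)‖) ^ 2 = (K ^ 2)⁻¹ * ((K ^ 2)⁻¹ * ‖A.toL2 (σ k)‖ ^ 2) := by
              ring
          _ ≤ (K ^ 2)⁻¹ * ‖A.toL2 (b k)‖ ^ 2 := by
              refine mul_le_mul_of_nonneg_left ?_ (by positivity)
              rwa [inv_mul_le_iff₀ (by positivity)]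
      have h8 : ε ^ 2 / K ^ 2 ≤ (K ^ 2)⁻¹ * ‖A.toL2 (b k)‖ ^ 2 := by
        rw [div_eq_inv_mul]
        exact mul_le_mul_of_nonneg_left h5 (by positivity)
      linarith
  have := csInf_le hΛbdd hmem
  linarith

section Systems

variable {ι : Type} [Fintype ι]

/-- The average over `n < N` of the products over `i` of the translates of `f i` by `g i n`. -/
noncomputable def systemAverage (g : ι → ℤ → H) (f : ι → B) (N : ℕ) : B :=
  (N : 𝕜)⁻¹ • ∑ n ∈ Finset.range N, ∏ i, A.act (g i n) (f i)

/-- Convergence, along the ultrafilter `p`, of the averages for a sequence `g` of systems and all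
uniformly bounded sequences of functions. -/
def SystemConverges (p : Ultrafilter ℕ) (g : ℕ → ι → ℤ → H) : Prop :=
  ∀ (C : ℝ) (f : ℕ → ι → B), (∀ k i, ‖f k i‖ ≤ C) →
    UltraCauchy p fun N k => A.toL2 (A.systemAverage (g k) (f k) N)

theorem norm_systemAverage_le [NormOneClass B] {g : ι → ℤ → H} {f : ι → B} {N : ℕ} {C : ℝ}
    (hC : 0 ≤ C) (hf : ∀ i, ‖f i‖ ≤ C) : ‖A.systemAverage g f N‖ ≤ C ^ Fintype.card ι :=
  norm_average_le (by positivity) fun n => norm_prod_le_pow fun i =>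
    (A.norm_act_le _ _).trans (hf i)

theorem systemConverges_of_eq_one {g : ℕ → ι → ℤ → H} (hg : ∀ᶠ k in p, ∀ i, g k i = 1) :
    A.SystemConverges p g := by
  intro C f hf
  refine (UltraCauchy.of_const fun k => A.toL2 (∏ i, f k i)).congr fun N hN => hg.mono fun k hk => ?_
  have hN' : (N : 𝕜) ≠ 0 := by exact_mod_cast (show N ≠ 0 by omega)
  simp only [systemAverage, hk, Pi.one_apply, map_one, AlgHom.one_apply, Finset.sum_const,
    Finset.card_range, ← Nat.cast_smul_eq_nsmul 𝕜, inv_smul_smul₀ hN']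

open Classical in
/-- The functions attached to the reduction of a system: the given functions on the members that are
kept, their conjugates on the new members, and `b` on the derivative of the removed member. -/
noncomputable def reducedFunctions (g : ι → ℤ → H) (f : ι → B) (j : ι) (b : B) : ι ⊕ ι → B
  | Sum.inl i => if g i = g j then (if i = j then b else 1) else f i
  | Sum.inr i => if g i = g j then 1 else A.conj (f i)

open Classical in
/-- The product of the members of the system different from `g j`. -/
noncomputable def otherFactors (g : ι → ℤ → H) (f : ι → B) (j : ι) (n : ℤ) : B :=
  ∏ i, if g i = g j then 1 else A.act (g i n) (f i)

open Classical in
theorem systemAverage_eq_weightedAverage (g : ι → ℤ → H) (f : ι → B) (j : ι) (N : ℕ) :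
    A.systemAverage g f N = A.weightedAverage (A.otherFactors g f j) (g j) N
      (∏ i, if g i = g j then f i else 1) := by
  rw [systemAverage, weightedAverage_apply]
  congr 1
  refine Finset.sum_congr rfl fun n _ => ?_
  rw [otherFactors, map_prod, ← Finset.prod_mul_distrib]
  refine Finset.prod_congr rfl fun i _ => ?_
  by_cases h : g i = g j <;> simp [h]

/-- The averages of the reduced system are correlations of the original system with translates of
the summands of a dual average. -/
theorem systemAverage_reduceSystem (g : ι → ℤ → H) (f : ι → B) (j : ι) (b : B) (n : ℤ) (M : ℕ) :
    A.systemAverage (reduceSystem g j n) (A.reducedFunctions g f j b) M =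
      (M : 𝕜)⁻¹ • ∑ m ∈ Finset.range M, A.otherFactors g f j m *
        A.act (g j m) (A.act (g j (m + n))⁻¹ (A.conj (A.otherFactors g f j (m + n)) * b)) := by
  classical
  rw [systemAverage]
  congr 1
  refine Finset.sum_congr rfl fun m _ => ?_
  have h1 : ∏ i, A.act (reduceSystem g j n (Sum.inl i) m)
      (A.reducedFunctions g f j b (Sum.inl i)) =
      A.otherFactors g f j m * A.act (g j m) (A.act (g j (m + n))⁻¹ b) := by
    have h2 : ∏ i, (if i = j then A.act (g j m) (A.act (g j (m + n))⁻¹ b) else 1) =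
        A.act (g j m) (A.act (g j (m + n))⁻¹ b) := by simp
    rw [← h2, otherFactors, ← Finset.prod_mul_distrib]
    refine Finset.prod_congr rfl fun i _ => ?_
    by_cases h : g i = g j
    · by_cases hij : i = j
      · simp [reduceSystem, reducedFunctions, hij, seqShift]
      · simp [reduceSystem, reducedFunctions, h, hij]
    · have hij : i ≠ j := fun hij => h (hij ▸ rfl)
      simp [reduceSystem, reducedFunctions, h, hij]
  have h3 : ∏ i, A.act (reduceSystem g j n (Sum.inr i) m)
      (A.reducedFunctions g f j b (Sum.inr i)) =
      A.act (g j m) (A.act (g j (m + n))⁻¹ (A.conj (A.otherFactors g f j (m + n)))) := by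
    rw [otherFactors, map_prod, map_prod, map_prod]
    refine Finset.prod_congr rfl fun i _ => ?_
    by_cases h : g i = g j
    · simp [reduceSystem, reducedFunctions, h]
    · simp [reduceSystem, reducedFunctions, h, seqShift, conj_act]
  rw [Fintype.prod_sum_type, h1, h3, map_mul, map_mul]
  ring

/-- If, for some choice of members, all reductions of a sequence of systems converge, then so does
the sequence itself. -/
theorem SystemConverges.of_reduceSystem [NormOneClass B] (hp : (p : Filter ℕ) ≤ atTop)
    {g : ℕ → ι → ℤ → H} (j : ℕ → ι)
    (h : ∀ n : ℕ → ℕ, A.SystemConverges p fun k => reduceSystem (g k) (j k) (n k)) :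
    A.SystemConverges p g := by
  classical
  intro C₀ f hf₀
  set C := max C₀ 1 with hCdef
  have hC1 : 1 ≤ C := le_max_right _ _
  have hC0 : 0 ≤ C := by linarith
  have hf : ∀ k i, ‖f k i‖ ≤ C := fun k i => (hf₀ k i).trans (le_max_left _ _)
  set F : ℕ → ℤ → B := fun k => A.otherFactors (g k) (f k) (j k) with hFdef
  set K := C ^ Fintype.card ι with hKdef
  have hK : 1 ≤ K := one_le_pow₀ hC1
  have hF : ∀ k n, ‖F k n‖ ≤ K := fun k n => norm_prod_le_pow fun i => by
    split_ifs
    · simpa using hC1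
    · exact (A.norm_act_le _ _).trans (hf k i)
  simp only [fun N k => A.systemAverage_eq_weightedAverage (g k) (f k) (j k) N]
  refine A.ultraCauchy_weightedAverage hp hK hF ?_ (C := K) fun k => norm_prod_le_pow fun i => by
    split_ifs
    · exact hf k i
    · simpa using hC1
  intro N hN Cb b hb
  have hCb : 0 ≤ Cb := (norm_nonneg _).trans (hb 0)
  set f' : ℕ → ι ⊕ ι → B := fun k => A.reducedFunctions (g k) (f k) (j k) (b k) with hf'def
  have hf' : ∀ k i, ‖f' k i‖ ≤ C + Cb := by
    rintro k (i | i) <;> simp only [hf'def, reducedFunctions] <;> split_ifs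
    · linarith [hb k]
    · simpa using by linarith
    · linarith [hf k i]
    · simpa using by linarith
    · linarith [(A.norm_conj_le (f k i)).trans (hf k i)]
  have hcauchy := UltraCauchy.average (𝕜 := 𝕜) hp N (a := fun M k n => A.toL2
    (A.systemAverage (reduceSystem (g k) (j k) n) (f' k) M))
    (C := (C + Cb) ^ Fintype.card (ι ⊕ ι)) (fun M k n => (A.norm_toL2_le _).trans
      (A.norm_systemAverage_le (by positivity) (hf' k))) fun n => h n _ f' hf'
  refine UltraCauchy.of_approx fun ε hε => ⟨_, hcauchy, 1, fun M hM => ?_⟩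
  -- replacing `n` by `m + n`, with `m < M`, in an average over `n < N k` costs `O(M / N k)`
  have hlim : Tendsto (fun k => K * ((N k : ℝ)⁻¹ * (M * (2 * (K * Cb))))) p (𝓝 0) := by
    have := ((tendsto_natCast_atTop_atTop (R := ℝ)).comp hN).inv_tendsto_atTop
    simpa using (this.mul_const ((M : ℝ) * (2 * (K * Cb)))).const_mul K
  filter_upwards [hlim.eventually_le_const hε] with k hk
  refine le_trans ?_ hk
  let Φ : ℕ → B := fun n => A.act (g k (j k) n)⁻¹ (A.conj (F k n) * b k)
  have hΦ : ∀ n, ‖Φ n‖ ≤ K * Cb := fun n => A.norm_act_conj_mul_le (g k (j k)) (hF k) (hb k) n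
  have heq : A.toL2 (A.weightedAverage (F k) (g k (j k)) M
        (A.dualAverage (F k) (g k (j k)) (N k) (b k))) -
      (N k : 𝕜)⁻¹ • ∑ n ∈ Finset.range (N k), A.toL2
        (A.systemAverage (reduceSystem (g k) (j k) n) (f' k) M) =
      A.toL2 ((M : 𝕜)⁻¹ • ∑ m ∈ Finset.range M, F k m * A.act (g k (j k) m) ((N k : 𝕜)⁻¹ •
        (∑ n ∈ Finset.range (N k), Φ n - ∑ n ∈ Finset.range (N k), Φ (m + n)))) := by
    rw [← map_sum, ← map_smul, ← map_sub]
    congr 1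
    rw [weightedAverage_apply]
    simp only [hf'def, systemAverage_reduceSystem]
    rw [← Finset.smul_sum, smul_comm, ← smul_sub]
    congr 1
    rw [Finset.sum_comm, Finset.smul_sum, ← Finset.sum_sub_distrib]
    refine Finset.sum_congr rfl fun m _ => ?_
    rw [smul_sub, map_sub, mul_sub]
    congr 1
    simp only [map_smul, map_sum, Finset.mul_sum, mul_smul_comm, Φ, hFdef, Nat.cast_add]
  rw [heq]
  refine (A.norm_toL2_le _).trans ?_
  rw [norm_smul, norm_inv, RCLike.norm_natCast, inv_mul_le_iff₀ (by exact_mod_cast hM)]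
  refine (norm_sum_le _ _).trans ?_
  have hterm : ∀ m ∈ Finset.range M, ‖F k m * A.act (g k (j k) m) ((N k : 𝕜)⁻¹ •
      (∑ n ∈ Finset.range (N k), Φ n - ∑ n ∈ Finset.range (N k), Φ (m + n)))‖ ≤
      K * ((N k : ℝ)⁻¹ * (M * (2 * (K * Cb)))) := fun m hm => by
    refine (norm_mul_le _ _).trans (mul_le_mul (hF k m) ((A.norm_act_le _ _).trans ?_)
      (norm_nonneg _) (by linarith))
    rw [norm_smul, norm_inv, RCLike.norm_natCast, norm_sub_rev]
    refine mul_le_mul_of_nonneg_left ((norm_sum_shift_sub_le hΦ m (N k)).trans ?_) (by positivity)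
    have : (m : ℝ) ≤ M := by exact_mod_cast (Finset.mem_range.1 hm).le
    exact mul_le_mul_of_nonneg_right this (by positivity)
  simpa using Finset.sum_le_card_nsmul _ _ _ hterm

end Systems

/-- Systems of sequences in the top group of a derivative chain converge, by induction on the
lexicographically ordered vectors of coset counts of a pivot. -/
theorem systemConverges_of_isPivot [NormOneClass B] (hp : (p : Filter ℕ) ≤ atTop)
    {P : ℕ → Subgroup (ℤ → H)} {r : ℕ} (hP : IsDerivChain P r) (v : Fin r → ℕ) :
    ∀ (ι : Type) [Fintype ι] (g : ℕ → ι → ℤ → H) (j : ℕ → ι), (∀ᶠ k in p,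
      IsPivot P (g k) (j k) ∧ (fun i : Fin r => cosetCount P (g k) (j k) i) = v) →
    A.SystemConverges p g := by
  classical
  induction v using (Pi.Lex.wellFounded (ι := Fin r) (· < ·) (s := fun {_} (a b : ℕ) => a < b)
    fun _ => wellFounded_lt).induction with
  | _ v ih =>
  intro ι _ g j hgj
  refine SystemConverges.of_reduceSystem A hp j fun n => ?_
  by_cases htriv : ∀ᶠ k in p, ∀ i, reduceSystem (g k) (j k) (n k) i = 1
  · exact A.systemConverges_of_eq_one htriv
  have hex : ∀ᶠ k in p, ∃ j', IsPivot P (reduceSystem (g k) (j k) (n k)) j' ∧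
      Pi.Lex (· < ·) (· < ·)
        (fun i : Fin r => cosetCount P (reduceSystem (g k) (j k) (n k)) j' i) v := by
    filter_upwards [hgj, Ultrafilter.eventually_not.2 htriv] with k hk hne
    rw [← hk.2]
    exact hk.1.exists_reduceSystem_lex hP _ (not_forall.1 hne)
  have hch : ∀ k, ∃ j' : ι ⊕ ι, (∃ j', IsPivot P (reduceSystem (g k) (j k) (n k)) j' ∧
      Pi.Lex (· < ·) (· < ·)
        (fun i : Fin r => cosetCount P (reduceSystem (g k) (j k) (n k)) j' i) v) →
      IsPivot P (reduceSystem (g k) (j k) (n k)) j' ∧ Pi.Lex (· < ·) (· < ·)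
        (fun i : Fin r => cosetCount P (reduceSystem (g k) (j k) (n k)) j' i) v := fun k =>
    by_cases (fun h => h.imp fun _ h' _ => h') fun h => ⟨Sum.inl (j k), fun h' => absurd h' h⟩
  choose j' hj' using hch
  -- the new vectors take finitely many values, one of them along `p`
  obtain ⟨v', -, hv'⟩ := Ultrafilter.exists_eventually_of_finite (p := p)
    (Set.finite_Iic (fun _ : Fin r => Fintype.card (ι ⊕ ι) + 1))
    (Q := fun v' k => IsPivot P (reduceSystem (g k) (j k) (n k)) (j' k) ∧
      (fun i : Fin r => cosetCount P (reduceSystem (g k) (j k) (n k)) (j' k) i) = v' ∧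
      Pi.Lex (· < ·) (· < ·) v' v)
    (hex.mono fun k hk => ⟨_, fun i => cosetCount_le _ _ _, (hj' k hk).1, rfl, (hj' k hk).2⟩)
  obtain ⟨k, -, -, hlt⟩ := hv'.exists
  exact ih v' hlt (ι ⊕ ι) _ j' (hv'.mono fun k hk => ⟨hk.1, hk.2.1⟩)

theorem cauchySeq_systemAverage [NormOneClass B] {P : ℕ → Subgroup (ℤ → H)} {r : ℕ}
    (hP : IsDerivChain P r) {ι : Type} [Fintype ι] (g : ι → ℤ → H) (hg : ∀ i, g i ∈ P 0)
    (f : ι → B) : CauchySeq fun N => A.toL2 (A.systemAverage g f N) := by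
  have hp : ((hyperfilter ℕ : Ultrafilter ℕ) : Filter ℕ) ≤ atTop := by
    rw [← Nat.cofinite_eq_atTop]; exact hyperfilter_le_cofinite
  have hconv : A.SystemConverges (hyperfilter ℕ) fun _ => g := by
    by_cases h1 : ∀ i, g i = 1
    · exact A.systemConverges_of_eq_one (.of_forall fun _ => h1)
    · obtain ⟨j, hj⟩ := hP.exists_isPivot hg (not_forall.1 h1)
      exact A.systemConverges_of_isPivot hp hP _ ι _ (fun _ => j) (.of_forall fun _ => ⟨hj, rfl⟩)
  have hC := hconv (∑ i, ‖f i‖) (fun _ => f) fun _ i =>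
    Finset.single_le_sum (f := fun i => ‖f i‖) (fun _ _ => norm_nonneg _) (Finset.mem_univ i)
  refine Metric.cauchySeq_iff.2 fun ε hε => ?_
  obtain ⟨M, hM⟩ := hC (ε / 2) (by positivity)
  refine ⟨M, fun N hN N' hN' => ?_⟩
  obtain ⟨_, h⟩ := (hM N hN N' hN').exists
  rw [dist_eq_norm]
  linarith

end L2Action

end Action

/-! ### Bounded functions modulo null sets -/

section Linfty

open scoped ENNReal

variable {𝕜 X : Type*} [RCLike 𝕜] [MeasurableSpace X] {μ : Measure X}

theorem eLpNorm_mul_le_top (q : ℝ≥0∞) (f g : X →ₘ[μ] 𝕜) :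
    eLpNorm (f * g : X →ₘ[μ] 𝕜) q μ ≤ eLpNorm f ∞ μ * eLpNorm g q μ := by
  rw [eLpNorm_congr_ae (AEEqFun.coeFn_mul f g)]
  exact eLpNorm_smul_le_eLpNorm_top_mul_eLpNorm q g.aestronglyMeasurable f

theorem coe_mul_mem_Lp_top (f g : Lp 𝕜 ∞ μ) : (f.1 * g.1 : X →ₘ[μ] 𝕜) ∈ Lp 𝕜 ∞ μ :=
  Lp.mem_Lp_iff_eLpNorm_lt_top.2 ((eLpNorm_mul_le_top ∞ f.1 g.1).trans_lt
    (ENNReal.mul_lt_top (Lp.eLpNorm_lt_top f) (Lp.eLpNorm_lt_top g)))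

theorem one_mem_Lp_top : (1 : X →ₘ[μ] 𝕜) ∈ Lp 𝕜 ∞ μ := by
  rw [Lp.mem_Lp_iff_eLpNorm_lt_top, eLpNorm_congr_ae AEEqFun.coeFn_one]
  exact (memLp_top_const (1 : 𝕜)).2

theorem MeasureTheory.AEEqFun.left_distrib (f g h : X →ₘ[μ] 𝕜) : f * (g + h) = f * g + f * h :=
  AEEqFun.induction_on₃ f g h fun f hf g hg h hh => by
    simp only [AEEqFun.mk_add_mk, AEEqFun.mk_mul_mk, mul_add]

theorem MeasureTheory.AEEqFun.smul_mul (c : 𝕜) (f g : X →ₘ[μ] 𝕜) : c • f * g = c • (f * g) :=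
  AEEqFun.induction_on₂ f g fun f hf g hg => by
    simp only [AEEqFun.smul_mk, AEEqFun.mk_mul_mk, smul_mul_assoc]

theorem MeasureTheory.AEEqFun.compMeasurePreserving_mul {σ : X → X} (hσ : MeasurePreserving σ μ μ)
    (f g : X →ₘ[μ] 𝕜) : (f * g).compMeasurePreserving σ hσ =
      f.compMeasurePreserving σ hσ * g.compMeasurePreserving σ hσ :=
  AEEqFun.induction_on₂ f g fun _ _ _ _ => rfl

theorem MeasureTheory.AEEqFun.star_compMeasurePreserving {σ : X → X} (hσ : MeasurePreserving σ μ μ)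
    (f : X →ₘ[μ] 𝕜) :
    star (f.compMeasurePreserving σ hσ) = (star f).compMeasurePreserving σ hσ :=
  AEEqFun.induction_on f fun _ _ => rfl

/-- `L^∞` with pointwise multiplication and the essential supremum norm. -/
noncomputable instance MeasureTheory.Lp.instNormedCommRingTop : NormedCommRing (Lp 𝕜 ∞ μ) :=
  { (inferInstance : NormedAddCommGroup (Lp 𝕜 ∞ μ)) with
    mul := fun f g => ⟨f.1 * g.1, coe_mul_mem_Lp_top f g⟩
    one := ⟨1, one_mem_Lp_top⟩
    mul_assoc := fun f g h => Subtype.ext (mul_assoc f.1 g.1 h.1)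
    mul_comm := fun f g => Subtype.ext (mul_comm f.1 g.1)
    one_mul := fun f => Subtype.ext (one_mul f.1)
    mul_one := fun f => Subtype.ext (mul_one f.1)
    left_distrib := fun f g h => Subtype.ext (AEEqFun.left_distrib f.1 g.1 h.1)
    right_distrib := fun f g h => Subtype.ext (by
      change (f.1 + g.1) * h.1 = f.1 * h.1 + g.1 * h.1
      rw [mul_comm, AEEqFun.left_distrib, mul_comm h.1, mul_comm h.1])
    zero_mul := fun f => Subtype.ext (by
      change (0 : X →ₘ[μ] 𝕜) * f.1 = 0
      have := AEEqFun.left_distrib f.1 0 0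
      rw [add_zero] at this
      rw [mul_comm]
      exact left_eq_add.1 this)
    mul_zero := fun f => Subtype.ext (by
      change f.1 * (0 : X →ₘ[μ] 𝕜) = 0
      have := AEEqFun.left_distrib f.1 0 0
      rw [add_zero] at this
      exact left_eq_add.1 this)
    norm_mul_le := fun f g => by
      change ENNReal.toReal _ ≤ ENNReal.toReal _ * ENNReal.toReal _
      rw [← ENNReal.toReal_mul]
      exact ENNReal.toReal_mono (ENNReal.mul_ne_top (Lp.eLpNorm_ne_top f) (Lp.eLpNorm_ne_top g))
        (eLpNorm_mul_le_top ∞ f.1 g.1) }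

theorem MeasureTheory.Lp.coeFn_mul_top (f g : Lp 𝕜 ∞ μ) : ⇑(f * g) =ᵐ[μ] ⇑f * ⇑g :=
  AEEqFun.coeFn_mul f.1 g.1

theorem MeasureTheory.Lp.coeFn_one_top : ⇑(1 : Lp 𝕜 ∞ μ) =ᵐ[μ] 1 := AEEqFun.coeFn_one

noncomputable instance MeasureTheory.Lp.instNormedAlgebraTop : NormedAlgebra 𝕜 (Lp 𝕜 ∞ μ) :=
  { Algebra.ofModule (R := 𝕜) (A := Lp 𝕜 ∞ μ)
      (fun c f g => Subtype.ext (AEEqFun.smul_mul c f.1 g.1))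
      (fun c f g => Subtype.ext (by
        change f.1 * c • g.1 = c • (f.1 * g.1)
        rw [mul_comm, AEEqFun.smul_mul, mul_comm])) with
    norm_smul_le := fun c f => norm_smul_le c f }

instance MeasureTheory.Lp.instNormOneClassTop [IsProbabilityMeasure μ] : NormOneClass (Lp 𝕜 ∞ μ) where
  norm_one := by
    rw [Lp.norm_def, eLpNorm_congr_ae Lp.coeFn_one_top]
    change (eLpNorm (fun _ => (1 : 𝕜)) ∞ μ).toReal = 1
    rw [eLpNorm_const _ (by simp) (IsProbabilityMeasure.ne_zero μ)]
    simp

theorem MeasureTheory.Lp.coeFn_prod_top {κ : Type*} (s : Finset κ) (f : κ → Lp 𝕜 ∞ μ) :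
    ⇑(∏ i ∈ s, f i) =ᵐ[μ] fun x => ∏ i ∈ s, f i x := by
  classical
  induction s using Finset.induction_on with
  | empty => simpa using! Lp.coeFn_one_top
  | insert a s ha ih =>
    rw [Finset.prod_insert ha]
    filter_upwards [Lp.coeFn_mul_top (f a) (∏ i ∈ s, f i), ih] with x h1 h2
    rw [h1, Pi.mul_apply, h2, Finset.prod_insert ha]

theorem MeasureTheory.Lp.coeFn_sum_top {κ : Type*} (s : Finset κ) (f : κ → Lp 𝕜 ∞ μ) :
    ⇑(∑ i ∈ s, f i) =ᵐ[μ] fun x => ∑ i ∈ s, f i x := by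
  classical
  induction s using Finset.induction_on with
  | empty => simpa using! Lp.coeFn_zero 𝕜 ∞ μ
  | insert a s ha ih =>
    rw [Finset.sum_insert ha]
    filter_upwards [Lp.coeFn_add (f a) (∑ i ∈ s, f i), ih] with x h1 h2
    rw [h1, Pi.add_apply, h2, Finset.sum_insert ha]

/-- A measure preserving action induces an action on `L^∞`, by `g • f = f ∘ τ g⁻¹`. -/
noncomputable def IsMeasurePreservingGroup.actTop {G : Type*} [Group G] {τ : G → X → X}
    (hτ : IsMeasurePreservingGroup μ τ) : G →* (Lp 𝕜 ∞ μ →ₐ[𝕜] Lp 𝕜 ∞ μ) where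
  toFun g := AlgHom.ofLinearMap
    (Lp.compMeasurePreservingₗ 𝕜 (τ g⁻¹) (hτ.measurePreserving g⁻¹)) (Subtype.ext rfl)
    (fun f h => Subtype.ext (AEEqFun.compMeasurePreserving_mul (hτ.measurePreserving g⁻¹) f.1 h.1))
  map_one' := by
    ext f
    refine (Lp.coeFn_compMeasurePreserving f (hτ.measurePreserving 1⁻¹)).trans ?_
    filter_upwards [hτ.map_one] with x hx
    simp [hx]
  map_mul' g h := by
    ext f
    refine (Lp.coeFn_compMeasurePreserving f (hτ.measurePreserving (g * h)⁻¹)).trans ?_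
    have h1 := Lp.coeFn_compMeasurePreserving
      (Lp.compMeasurePreserving _ (hτ.measurePreserving h⁻¹) f) (hτ.measurePreserving g⁻¹)
    refine Filter.EventuallyEq.trans ?_ h1.symm
    have h2 := (hτ.measurePreserving g⁻¹).quasiMeasurePreserving.ae_eq_comp
      (Lp.coeFn_compMeasurePreserving f (hτ.measurePreserving h⁻¹))
    filter_upwards [h2, hτ.map_mul h⁻¹ g⁻¹] with x hx hx'
    rw [hx, Function.comp_apply, mul_inv_rev, hx']
    rfl

theorem IsMeasurePreservingGroup.coeFn_actTop {G : Type*} [Group G] {τ : G → X → X}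
    (hτ : IsMeasurePreservingGroup μ τ) (g : G) (f : Lp 𝕜 ∞ μ) :
    ⇑(hτ.actTop g f) =ᵐ[μ] ⇑f ∘ τ g⁻¹ :=
  Lp.coeFn_compMeasurePreserving f (hτ.measurePreserving g⁻¹)

variable [IsProbabilityMeasure μ]

theorem MeasureTheory.Lp.val_mem_two (f : Lp 𝕜 ∞ μ) : f.1 ∈ Lp 𝕜 2 μ :=
  Lp.mem_Lp_iff_eLpNorm_lt_top.2
    ((eLpNorm_le_eLpNorm_of_exponent_le le_top (Lp.aestronglyMeasurable f)).trans_lt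
      (Lp.eLpNorm_lt_top f))

/-- The inclusion of `L^∞` in `L²` over a probability space. -/
noncomputable def topToTwo : Lp 𝕜 ∞ μ →ₗ[𝕜] Lp 𝕜 2 μ where
  toFun f := ⟨f.1, Lp.val_mem_two f⟩
  map_add' _ _ := rfl
  map_smul' _ _ := rfl

theorem coeFn_topToTwo (f : Lp 𝕜 ∞ μ) : ⇑(topToTwo f) = ⇑f := rfl

/-- The action on bounded functions of a group of measure preserving transformations. -/
noncomputable def IsMeasurePreservingGroup.l2Action {G : Type*} [Group G] {τ : G → X → X}
    (hτ : IsMeasurePreservingGroup μ τ) : L2Action 𝕜 G (Lp 𝕜 ∞ μ) (Lp 𝕜 2 μ) where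
  toL2 := topToTwo
  conj :=
    { toFun := star
      map_one' := by
        ext
        filter_upwards [Lp.coeFn_star (1 : Lp 𝕜 ∞ μ), Lp.coeFn_one_top (𝕜 := 𝕜) (μ := μ)]
          with x h1 h2
        simp [h1, h2]
      map_mul' := fun f g => by
        ext
        filter_upwards [Lp.coeFn_star (f * g), Lp.coeFn_mul_top f g,
          Lp.coeFn_mul_top (star f) (star g), Lp.coeFn_star f, Lp.coeFn_star g]
          with x h1 h2 h3 h4 h5
        simp [h1, h2, h3, h4, h5] }
  act := hτ.actTop
  norm_toL2_le f := ENNReal.toReal_mono (Lp.eLpNorm_ne_top f)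
    (eLpNorm_le_eLpNorm_of_exponent_le le_top (Lp.aestronglyMeasurable f))
  norm_toL2_mul_le f h := by
    change ENNReal.toReal _ ≤ ENNReal.toReal _ * ENNReal.toReal _
    rw [← ENNReal.toReal_mul]
    exact ENNReal.toReal_mono
      (ENNReal.mul_ne_top (Lp.eLpNorm_ne_top f) (Lp.eLpNorm_ne_top (topToTwo h)))
      (eLpNorm_mul_le_top 2 f.1 h.1)
  norm_conj_le f := by
    change ‖star f‖ ≤ ‖f‖
    rw [Lp.norm_def, Lp.norm_def, eLpNorm_congr_ae (Lp.coeFn_star f)]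
    exact (congrArg ENNReal.toReal (eLpNorm_congr_norm_ae (.of_forall fun x => by simp))).le
  norm_act_le g f := (Lp.norm_compMeasurePreserving f (hτ.measurePreserving g⁻¹)).le
  conj_act g f := Subtype.ext (AEEqFun.star_compMeasurePreserving (hτ.measurePreserving g⁻¹) f.1)
  inner_mul_left f h k := by
    rw [L2.inner_def, L2.inner_def]
    refine integral_congr_ae ?_
    simp only [coeFn_topToTwo]
    filter_upwards [Lp.coeFn_mul_top f h, Lp.coeFn_mul_top (star f) k, Lp.coeFn_star f]
      with x h1 h2 h3
    change inner 𝕜 _ _ = inner 𝕜 _ ((star f * k : Lp 𝕜 ∞ μ) x)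
    rw [h1, h2]
    simp only [Pi.mul_apply, h3, Pi.star_apply, RCLike.inner_apply, RCLike.star_def,
      _root_.map_mul (starRingEnd 𝕜)]
    ring
  inner_act g f h := (Lp.compMeasurePreservingₗᵢ 𝕜 (p := 2) (E := 𝕜) (τ g⁻¹)
    (hτ.measurePreserving g⁻¹)).inner_map_map (topToTwo f) (topToTwo h)

/-- The averages in the theorem are those of the system of the inverse sequences, because the action
on functions is by `f ∘ τ g⁻¹`; the translation by `1` accounts for averaging over `1 ≤ n ≤ N`. -/
theorem IsMeasurePreservingGroup.coeFn_systemAverage {G : Type*} [Group G] {τ : G → X → X}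
    (hτ : IsMeasurePreservingGroup μ τ) {l d : ℕ} (T : Fin l → G) (p : Fin l → Fin d → ℤ → ℤ)
    {f : Fin d → X → 𝕜} (hf : ∀ j, MemLp (f j) ∞ μ) (N : ℕ) :
    ⇑(hτ.l2Action.toL2 (hτ.l2Action.systemAverage
      (fun j => (seqShift 1 fun n => polynomialProduct T (fun i => p i j) n)⁻¹)
      (fun j => (hf j).toLp (f j)) N)) =ᵐ[μ] polynomialAverage τ T p f N := by
  let S : Fin d → ℕ → G := fun j n => polynomialProduct T (fun i => p i j) ((n : ℤ) + 1)
  let B : ℕ → Fin d → Lp 𝕜 ∞ μ := fun n j => hτ.actTop (S j n)⁻¹ ((hf j).toLp (f j))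
  have hB : ∀ n j, ⇑(B n j) =ᵐ[μ] f j ∘ τ (S j n) := fun n j => by
    refine (hτ.coeFn_actTop (S j n)⁻¹ _).trans ?_
    rw [inv_inv]
    exact (hτ.measurePreserving _).quasiMeasurePreserving.ae_eq_comp (hf j).coeFn_toLp
  change ⇑((N : 𝕜)⁻¹ • ∑ n ∈ Finset.range N, ∏ j, B n j : Lp 𝕜 ∞ μ) =ᵐ[μ] _
  have h1 : ∀ᵐ x ∂μ, ∀ n j, B n j x = f j (τ (S j n) x) :=
    ae_all_iff.2 fun n => ae_all_iff.2 fun j => hB n j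
  have h2 : ∀ᵐ x ∂μ, ∀ n, (∏ j, B n j : Lp 𝕜 ∞ μ) x = ∏ j, B n j x :=
    ae_all_iff.2 fun n => Lp.coeFn_prod_top _ _
  filter_upwards [h1, h2, Lp.coeFn_smul (N : 𝕜)⁻¹ (∑ n ∈ Finset.range N, ∏ j, B n j : Lp 𝕜 ∞ μ),
    Lp.coeFn_sum_top (Finset.range N) fun n => ∏ j, B n j] with x h1 h2 h3 h4
  rw [h3, Pi.smul_apply, h4, smul_eq_mul, polynomialAverage, Finset.range_eq_Ico,
    ← Finset.Ico_add_one_right_eq_Icc, ← zero_add 1, ← Finset.sum_Ico_add'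
      (fun n : ℕ => ∏ j, f j (τ (polynomialProduct T (fun i => p i j) (n : ℤ)) x)) 0 N 1]
  simp only [h2, h1, S, Nat.cast_add, Nat.cast_one]

end Linfty

theorem theorem1p1 {𝕜 : Type*} [RCLike 𝕜] {G : Type*} [Group G] [Group.IsNilpotent G]
    {X : Type*} [MeasurableSpace X] (μ : Measure X) [IsProbabilityMeasure μ]
    (τ : G → X → X) (hτ : IsMeasurePreservingGroup μ τ)
    (l d : ℕ) (T : Fin l → G)
    (p : Fin l → Fin d → ℤ → ℤ) (hp : ∀ i j, IsIntegerValuedPolynomial (p i j))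
    (f : Fin d → X → 𝕜) (hf : ∀ j, MemLp (f j) ⊤ μ) :
    ∃ F : X → 𝕜, MemLp F 2 μ ∧
      Filter.Tendsto (fun N : ℕ => eLpNorm (fun x => polynomialAverage τ T p f N x - F x) 2 μ)
        Filter.atTop (nhds 0) := by
  obtain ⟨P, r, hP, hmem⟩ := exists_isDerivChain T p hp
  have hcauchy := hτ.l2Action.cauchySeq_systemAverage hP
    (fun j => (seqShift 1 fun n => polynomialProduct T (fun i => p i j) n)⁻¹)
    (fun j => inv_mem (hP.seqShift_mem (hmem j) 1)) (fun j => (hf j).toLp (f j))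
  obtain ⟨F, hF⟩ := cauchySeq_tendsto_of_complete hcauchy
  refine ⟨F, Lp.memLp F, ?_⟩
  rw [Lp.tendsto_Lp_iff_tendsto_eLpNorm'] at hF
  refine hF.congr fun N => eLpNorm_congr_ae ?_
  filter_upwards [hτ.coeFn_systemAverage T p hf N] with x hx
  rw [Pi.sub_apply, hx]
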